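/- Let $G$ be a finite simple graph (not necessarily connected). Let $p(G)$ be the number of positive eigenvalues (counted with multiplicity) of its adjacency matrix, $m(G)$ its matching number (the largest number of edges in a matching), and $c(G)=|E(G)|-|V(G)|+\theta(G)$ its cyclomatic number, where $\theta(G)$ is the number of connected components. Then $p(G)=m(G)+c(G)$ if and only if the following three conditions all hold: (i) any two distinct cycles of $G$ share no common vertices; (ii) each cycle of $G$ has length congruent to $1$ modulo $4$; (iii) $m(T_G)=m([T_G])$, where $T_G$ is the graph obtained from $G$ by contracting each cycle of $G$ to a vertex (called a cyclic vertex), which is a forest when (i) holds, and $[T_G]$ is the subgraph of $T_G$ induced by its non-cyclic vertices. -/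

import Mathlib

namespace GraphInertia

variable {V : Type*}

theorem adjMatrix_isHermitian [DecidableEq V] (G : SimpleGraph V) [DecidableRel G.Adj] :
    (G.adjMatrix ℝ).IsHermitian := by
  rw [Matrix.IsHermitian, Matrix.conjTranspose_eq_transpose_of_trivial]
  exact G.isSymm_adjMatrix

/-- The number `p(G)` of positive eigenvalues, counted with multiplicity, of the real adjacency
matrix of `G`. -/
noncomputable def posInertia [Fintype V] [DecidableEq V] (G : SimpleGraph V)
    [DecidableRel G.Adj] : ℕ :=
  (Finset.univ.filter fun i : V =>
    0 < (adjMatrix_isHermitian G).eigenvalues i).card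

/-- The matching number `m(G)`: the largest number of edges of a matching. On a finite vertex type
the supremum is over a non-empty bounded set of natural numbers, so it is a maximum. -/
noncomputable def matchingNumber (G : SimpleGraph V) : ℕ :=
  sSup {k : ℕ | ∃ M : G.Subgraph, M.IsMatching ∧ M.edgeSet.ncard = k}

/-- The cyclomatic number `c(G) = |E(G)| - |V(G)| + θ(G)`, where `θ(G)` is the number of connected
components. The subtraction takes place in `ℤ`. -/
noncomputable def cyclomaticNumber (G : SimpleGraph V) : ℤ :=
  (Nat.card G.edgeSet : ℤ) - (Nat.card V : ℤ) + (Nat.card G.ConnectedComponent : ℤ)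

/-- `C` is a cycle of `G`, as a subgraph. -/
def IsCycleSubgraph (G : SimpleGraph V) (C : G.Subgraph) : Prop :=
  ∃ (v : V) (p : G.Walk v v), p.IsCycle ∧ p.toSubgraph = C

/-- Any two distinct cycles of `G` share no vertex. -/
def CyclesDisjoint (G : SimpleGraph V) : Prop :=
  ∀ C D : G.Subgraph, IsCycleSubgraph G C → IsCycleSubgraph G D → C ≠ D →
    Disjoint C.verts D.verts

/-- `v` and `w` lie on a common cycle of `G`. -/
def OnCommonCycle (G : SimpleGraph V) (v w : V) : Prop :=
  ∃ C : G.Subgraph, IsCycleSubgraph G C ∧ v ∈ C.verts ∧ w ∈ C.verts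

/-- The vertices of `T_G`: `Quot` identifies all vertices that lie on a common cycle (it divides by
the equivalence relation generated). If the cycles of `G` are vertex-disjoint, the classes are
exactly the vertex sets of the cycles and the singletons of the vertices on no cycle. -/
def ContractedVertex (G : SimpleGraph V) : Type _ :=
  Quot (OnCommonCycle G)

/-- The graph `T_G` obtained from `G` by contracting each cycle to a vertex: two distinct classes
are adjacent when some edge of `G` joins them. -/
def contraction (G : SimpleGraph V) : SimpleGraph (ContractedVertex G) :=
  G.map (Quot.mk (OnCommonCycle G))

/-- The cyclic vertices of `T_G`: those that arise from a cycle of `G`. -/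
def cyclicVertices (G : SimpleGraph V) : Set (ContractedVertex G) :=
  {q | ∃ C : G.Subgraph, IsCycleSubgraph G C ∧ ∃ v ∈ C.verts, Quot.mk (OnCommonCycle G) v = q}

/-- `[T_G]`: the subgraph of `T_G` induced by its non-cyclic vertices. -/
def noncyclicPart (G : SimpleGraph V) :
    SimpleGraph ((cyclicVertices G)ᶜ : Set (ContractedVertex G)) :=
  (contraction G).induce (cyclicVertices G)ᶜ

end GraphInertia

/-!
The proof works with graphs on a fixed vertex type and isolates a vertex `x`, in place of deleting
it, by `G.deleteIncidenceSet x`; isolated vertices affect none of `p`, `m`, `c`.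

*Upper bound.* Isolating a vertex lowers `p` by at most one. A vertex on a cycle lowers `c` by at
least one, and the neighbour of a pendant vertex lowers `m` by at least one, so `p ≤ m + c` follows
by induction on the number of edges (`inertia_le_matchingNumber_add`).

*Reformulation.* Edges on cycles form the graph `core G`; the others are the bridges. The
contraction `T_G` is a forest, and Kőnig's theorem in `T_G` turns condition (iii) into the existence
of a vertex cover `U` of the bridges of `G` that avoids all cycles and is no larger than a matching
that avoids all cycles (`BridgeCover`, `exists_bridgeCover_iff`).

*Extremal graphs satisfy the conditions* (`IsExtremal.cycleCriterion`). If `G` is extremal, then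
isolating a vertex `x` of a cycle leaves an extremal graph with the same `m` and with `c` smaller by
exactly one, which already makes the cycles disjoint. If there is a bridge, then there is an
extremal one `xy`: either `x` is pendant, or `x` lies on a cycle that `xy` alone joins to the rest
of the graph. In both cases `y` lies on no cycle, `G - y` is extremal, and a bridge cover of `G - y`
becomes one of `G` by adding `y`; the matching this needs comes from comparing `m(G - y) < m(G)`
with `m(G - x) = m(G)`. A bridgeless extremal graph is a disjoint union of cycles, and the form of
an `n`-cycle is nonpositive on a subspace of codimension `n / 2` unless `n ≡ 1 mod 4`.

*Conversely* (`CycleCriterion.isExtremal`), a nonempty bridge cover `U` contains the neighbour `u`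
of a pendant vertex, and isolating `u` lowers both `p` and `m` by one; once `U` is empty, `G` is a
disjoint union of cycles of length `n ≡ 1 mod 4`, each of which contributes `(n + 1) / 2` to `p`.
-/

namespace GraphInertia

/-! ### The positive inertia index as a signature -/

section Inertia

open Module QuadraticForm

variable {V : Type*} [Fintype V]

open Classical in
/-- The adjacency matrix with the classical decidability instance, as a bare function. -/
noncomputable def adjInd {V : Type*} (G : SimpleGraph V) (a b : V) : ℝ :=
  if G.Adj a b then 1 else 0

theorem adjInd_of_adj {V : Type*} {G : SimpleGraph V} {a b : V} (h : G.Adj a b) :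
    adjInd G a b = 1 := if_pos h

theorem adjInd_of_not_adj {V : Type*} {G : SimpleGraph V} {a b : V} (h : ¬ G.Adj a b) :
    adjInd G a b = 0 := if_neg h

open Classical in
/-- The quadratic form `x ↦ xᵀ A x` of the adjacency matrix `A` of `G`. -/
noncomputable def adjForm (G : SimpleGraph V) : QuadraticForm ℝ (V → ℝ) :=
  Matrix.toQuadraticForm' (Matrix.of (adjInd G))

theorem adjForm_apply (G : SimpleGraph V) (x : V → ℝ) :
    adjForm G x = ∑ a, ∑ b, adjInd G a b * (x a * x b) := by
  simp only [adjForm, Matrix.toQuadraticForm', LinearMap.BilinMap.toQuadraticMap_apply,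
    Matrix.toLinearMap₂'_apply', dotProduct, Matrix.mulVec, Finset.mul_sum, Matrix.of_apply]
  exact Finset.sum_congr rfl fun a _ => Finset.sum_congr rfl fun b _ => by ring

/-- Orthogonal diagonalization makes `adjForm G` a weighted sum of squares, the weights being the
eigenvalues; Sylvester's law of inertia does the rest. -/
theorem posInertia_eq_sigPos [DecidableEq V] (G : SimpleGraph V) [DecidableRel G.Adj] :
    posInertia G = sigPos (adjForm G) := by
  set hA := adjMatrix_isHermitian G
  have hQ : ∀ x, adjForm G x = x ⬝ᵥ (G.adjMatrix ℝ).mulVec x := by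
    intro x
    rw [adjForm_apply]
    simp only [dotProduct, Matrix.mulVec, Finset.mul_sum, SimpleGraph.adjMatrix_apply]
    refine Finset.sum_congr rfl fun a _ => Finset.sum_congr rfl fun b _ => ?_
    by_cases h : G.Adj a b
    · simp [adjInd_of_adj h, h]
    · simp [adjInd_of_not_adj h, h]
  let e : (V → ℝ) ≃ₗ[ℝ] (V → ℝ) := Matrix.UnitaryGroup.toLinearEquiv hA.eigenvectorUnitary
  have hequiv : QuadraticMap.Equivalent
      (QuadraticMap.weightedSumSquares ℝ hA.eigenvalues) (adjForm G) := by
    refine ⟨⟨e, fun x => ?_⟩⟩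
    have he : e x = (hA.eigenvectorUnitary : Matrix V V ℝ).mulVec x := rfl
    have h1 : e.toFun x = e x := rfl
    rw [h1, hQ, he]
    have hs := hA.spectral_theorem
    rw [Unitary.conjStarAlgAut_apply] at hs
    have hU : star (hA.eigenvectorUnitary : Matrix V V ℝ) * (hA.eigenvectorUnitary : Matrix V V ℝ)
        = 1 := by simp
    have : (G.adjMatrix ℝ).mulVec ((hA.eigenvectorUnitary : Matrix V V ℝ).mulVec x) =
        (hA.eigenvectorUnitary : Matrix V V ℝ).mulVec
          ((Matrix.diagonal hA.eigenvalues).mulVec x) := by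
      rw [Matrix.mulVec_mulVec, Matrix.mulVec_mulVec]
      congr 1
      refine (congrArg (· * (hA.eigenvectorUnitary : Matrix V V ℝ)) hs).trans ?_
      rw [mul_assoc, hU, mul_one]
      rfl
    rw [this, Matrix.dotProduct_mulVec, ← Matrix.mulVec_transpose, Matrix.mulVec_mulVec]
    have hT : (hA.eigenvectorUnitary : Matrix V V ℝ).transpose
        = star (hA.eigenvectorUnitary : Matrix V V ℝ) := by
      rw [Matrix.star_eq_conjTranspose, Matrix.conjTranspose_eq_transpose_of_trivial]
    rw [hT, hU, Matrix.one_mulVec]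
    simp only [dotProduct, Matrix.mulVec_diagonal, QuadraticMap.weightedSumSquares_apply,
      smul_eq_mul]
    exact Finset.sum_congr rfl fun i _ => by ring
  rw [sigPos_of_equiv_weightedSumSquares hequiv.symm, posInertia, ← Set.ncard_coe_finset]
  congr 1
  ext i
  simp

/-- The positive inertia index of the adjacency form: the largest dimension of a subspace on which
it is positive definite. -/
noncomputable def inertia (G : SimpleGraph V) : ℕ := sigPos (adjForm G)

theorem finrank_le_inertia {E : Type*} [AddCommGroup E] [Module ℝ E] (G : SimpleGraph V)
    (J : E →ₗ[ℝ] (V → ℝ)) (hJ : ∀ y, y ≠ 0 → 0 < adjForm G (J y)) :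
    finrank ℝ E ≤ inertia G := by
  have hinj : Function.Injective J := by
    rw [← LinearMap.ker_eq_bot, LinearMap.ker_eq_bot']
    intro y hy
    by_contra h
    have := hJ y h
    simp [hy] at this
  rw [← LinearMap.finrank_range_of_inj hinj]
  refine le_sigPos_of_posDef _ ?_
  rintro ⟨_, y, rfl⟩ hx
  refine hJ y ?_
  rintro rfl
  simp at hx

theorem exists_subspace_posDef (G : SimpleGraph V) :
    ∃ W : Submodule ℝ (V → ℝ), finrank ℝ W = inertia G ∧
      ∀ x ∈ W, x ≠ 0 → 0 < adjForm G x := by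
  obtain ⟨W, h1, h2⟩ := exists_finrank_eq_sigPos_and_posDef (adjForm G)
  exact ⟨W, h1, fun x hx h0 => h2 ⟨x, hx⟩ (by simpa using h0)⟩

/-- If the form of `G` is at most that of `G'` on the kernel of a linear map to a space of
dimension `k`, then the inertia index of `G` exceeds that of `G'` by at most `k`. -/
theorem inertia_le_add {E : Type*} [AddCommGroup E] [Module ℝ E] [FiniteDimensional ℝ E]
    {G G' : SimpleGraph V} (L : (V → ℝ) →ₗ[ℝ] E)
    (h : ∀ x, L x = 0 → adjForm G x ≤ adjForm G' x) :
    inertia G ≤ inertia G' + finrank ℝ E := by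
  obtain ⟨W, hW, hpos⟩ := exists_subspace_posDef G
  have h1 := (L.domRestrict W).finrank_range_add_finrank_ker
  have h2 : finrank ℝ (LinearMap.range (L.domRestrict W)) ≤ finrank ℝ E :=
    Submodule.finrank_le _
  have h3 : finrank ℝ (LinearMap.ker (L.domRestrict W)) ≤ inertia G' := by
    refine finrank_le_inertia (E := LinearMap.ker (L.domRestrict W)) G'
      (W.subtype ∘ₗ (LinearMap.ker (L.domRestrict W)).subtype) ?_
    rintro ⟨⟨y, hyW⟩, hy⟩ h0
    have hy' : L y = 0 := hy
    have hy0 : y ≠ 0 := by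
      rintro rfl
      exact h0 rfl
    exact (hpos y hyW hy0).trans_le (h y hy')
  omega

/-- A positive definite block of dimension `dim F` can be added to a maximal positive definite
subspace for `G'`, once `J` combines the two in a way compatible with the forms. -/
theorem inertia_add_le {F : Type*} [AddCommGroup F] [Module ℝ F] [FiniteDimensional ℝ F]
    {G G' : SimpleGraph V} (J : ((V → ℝ) × F) →ₗ[ℝ] (V → ℝ)) (q : F → ℝ)
    (hq : ∀ t, t ≠ 0 → 0 < q t) (hq0 : q 0 = 0)
    (h : ∀ x t, adjForm G (J (x, t)) = adjForm G' x + q t) :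
    inertia G' + finrank ℝ F ≤ inertia G := by
  obtain ⟨W, hW, hpos⟩ := exists_subspace_posDef G'
  rw [← hW, ← Module.finrank_prod]
  refine finrank_le_inertia G (J ∘ₗ (W.subtype.prodMap LinearMap.id)) ?_
  rintro ⟨⟨x, hx⟩, t⟩ h0
  have : adjForm G ((J ∘ₗ (W.subtype.prodMap LinearMap.id)) (⟨x, hx⟩, t)) =
      adjForm G' x + q t := h x t
  rw [this]
  by_cases hx0 : x = 0
  · subst hx0
    have ht : t ≠ 0 := by
      rintro rfl
      exact h0 rfl
    simpa using hq t ht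
  · have h1 := hpos x hx hx0
    by_cases ht : t = 0
    · rw [ht, hq0, add_zero]
      exact h1
    · exact add_pos h1 (hq t ht)

theorem inertia_bot : inertia (⊥ : SimpleGraph V) = 0 := by
  obtain ⟨W, hW, hpos⟩ := exists_subspace_posDef (⊥ : SimpleGraph V)
  rw [← hW, Submodule.finrank_eq_zero, Submodule.eq_bot_iff]
  intro x hx
  by_contra h
  have := hpos x hx h
  rw [adjForm_apply] at this
  simp [adjInd] at this

theorem adjForm_congr (G : SimpleGraph V) {x y : V → ℝ} (h : ∀ a ∈ G.support, x a = y a) :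
    adjForm G x = adjForm G y := by
  simp only [adjForm_apply]
  refine Finset.sum_congr rfl fun a _ => Finset.sum_congr rfl fun b _ => ?_
  by_cases hab : G.Adj a b
  · rw [h a ⟨b, hab⟩, h b ⟨a, hab.symm⟩]
  · simp [adjInd_of_not_adj hab]

theorem adjForm_sdiff {G C : SimpleGraph V} (hC : C ≤ G) (x : V → ℝ) :
    adjForm G x = adjForm (G \ C) x + adjForm C x := by
  simp only [adjForm_apply, ← Finset.sum_add_distrib]
  refine Finset.sum_congr rfl fun a _ => Finset.sum_congr rfl fun b _ => ?_
  rw [← add_mul]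
  congr 1
  by_cases h1 : C.Adj a b
  · simp [adjInd, h1, hC h1]
  · have h2 : (G \ C).Adj a b ↔ G.Adj a b := by simp [SimpleGraph.sdiff_adj, h1]
    rw [adjInd_of_not_adj h1, add_zero, adjInd, adjInd, propext h2]

theorem adjForm_deleteIncidenceSet (G : SimpleGraph V) (u : V) (x : V → ℝ) :
    adjForm G x = adjForm (G.deleteIncidenceSet u) x +
      2 * (x u * ∑ z, adjInd G u z * x z) := by
  classical
  have key : ∀ a b, adjInd G a b * (x a * x b) =
      adjInd (G.deleteIncidenceSet u) a b * (x a * x b) +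
      ((if a = u then x u * (adjInd G u b * x b) else 0) +
       (if b = u then x u * (adjInd G u a * x a) else 0)) := by
    intro a b
    by_cases hb : b = u
    · subst hb
      by_cases ha : a = b
      · subst ha; simp [adjInd]
      · simp [adjInd, SimpleGraph.deleteIncidenceSet_adj, ha, G.adj_comm a b]
        split_ifs <;> ring
    · by_cases ha : a = u
      · subst ha
        simp [adjInd, SimpleGraph.deleteIncidenceSet_adj, hb]
      · simp [adjInd, SimpleGraph.deleteIncidenceSet_adj, ha, hb]
  simp only [adjForm_apply, key, Finset.sum_add_distrib]
  congr 1
  rw [Finset.mul_sum, two_mul]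
  congr 1
  · rw [Finset.sum_eq_single u (by intro b _ hb; simp [hb]) (by simp)]
    exact Finset.sum_congr rfl fun b _ => if_pos rfl
  · refine Finset.sum_congr rfl fun a _ => ?_
    rw [Finset.sum_ite_eq' Finset.univ u, if_pos (Finset.mem_univ u)]

/-- Interlacing: deleting a vertex lowers the positive inertia index by at most one. -/
theorem inertia_le_deleteIncidenceSet (G : SimpleGraph V) (u : V) :
    inertia G ≤ inertia (G.deleteIncidenceSet u) + 1 := by
  have := inertia_le_add (G := G) (G' := G.deleteIncidenceSet u) (LinearMap.proj (R := ℝ) u) ?_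
  · simpa using this
  · intro x hx
    have hx' : x u = 0 := hx
    rw [adjForm_deleteIncidenceSet G u x, hx']
    simp

/-- A vertex `u` with a pendant neighbour `u'`: `x_{u'}` can be chosen so as to make the part of the
form that involves `x_u` equal to `2 x_u ^ 2`. -/
theorem inertia_pendant (G : SimpleGraph V) {u u' : V} (h : G.Adj u u')
    (hpend : ∀ z, G.Adj u' z → z = u) :
    inertia (G.deleteIncidenceSet u) + 1 ≤ inertia G := by
  classical
  let J : ((V → ℝ) × ℝ) →ₗ[ℝ] (V → ℝ) :=
    { toFun := fun p w => if w = u then p.2 else if w = u' then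
        p.2 - ∑ z, (if z = u' then 0 else adjInd G u z * p.1 z) else p.1 w
      map_add' := by
        intro p q
        ext w
        simp only [Prod.fst_add, Prod.snd_add, Pi.add_apply]
        split_ifs
        · rfl
        · rw [← add_sub_add_comm, ← Finset.sum_add_distrib]
          congr 1
          refine Finset.sum_congr rfl fun z _ => ?_
          split_ifs
          · simp
          · ring
        · rfl
      map_smul' := by
        intro c p
        ext w
        simp only [Prod.smul_fst, Prod.smul_snd, Pi.smul_apply, smul_eq_mul, RingHom.id_apply]
        split_ifs
        · rfl
        · rw [mul_sub, Finset.mul_sum]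
          congr 1
          refine Finset.sum_congr rfl fun z _ => ?_
          split_ifs
          · simp
          · ring
        · rfl }
  have hJ : ∀ x t w, J (x, t) w = if w = u then t else if w = u' then
        t - ∑ z, (if z = u' then 0 else adjInd G u z * x z) else x w := fun _ _ _ => rfl
  have := inertia_add_le (G := G) (G' := G.deleteIncidenceSet u) J (fun t => 2 * (t * t))
    (fun t ht => mul_pos two_pos (mul_self_pos.mpr ht)) (by simp) ?_
  · simpa using this
  · intro x t
    rw [adjForm_deleteIncidenceSet G u]
    congr 1
    · refine adjForm_congr _ fun a ha => ?_
      obtain ⟨b, hb⟩ := ha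
      replace hb := SimpleGraph.deleteIncidenceSet_adj.mp hb
      have h2 : a ≠ u' := by
        rintro rfl
        exact hb.2.2 (hpend b hb.1)
      rw [hJ, if_neg hb.2.1, if_neg h2]
    · have hu : J (x, t) u = t := by rw [hJ]; simp
      have hu'u : u' ≠ u := h.ne'
      have hu' : J (x, t) u' = t - ∑ z, (if z = u' then 0 else adjInd G u z * x z) := by
        rw [hJ]; simp [hu'u]
      have hs : ∑ z, adjInd G u z * J (x, t) z = t := by
        have : ∀ z, adjInd G u z * J (x, t) z =
            (if z = u' then J (x, t) u' else 0) +
              (if z = u' then 0 else adjInd G u z * x z) := by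
          intro z
          by_cases hz : z = u'
          · subst hz; simp [adjInd_of_adj h]
          · by_cases hz2 : G.Adj u z
            · simp [hz, hJ, hz2.ne']
            · simp [hz, adjInd_of_not_adj hz2]
        simp only [this, Finset.sum_add_distrib, Finset.sum_ite_eq', Finset.mem_univ, if_true, hu']
        ring
      rw [hu, hs]

/-- Positive definite subspaces on a component `C` and on the rest of the graph combine. -/
theorem inertia_sdiff_add_le {F : Type*} [AddCommGroup F] [Module ℝ F] [FiniteDimensional ℝ F]
    {G C : SimpleGraph V} (hC : C ≤ G) (hdisj : Disjoint (G \ C).support C.support)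
    (J : F →ₗ[ℝ] (V → ℝ)) (hJ : ∀ t, t ≠ 0 → 0 < adjForm C (J t)) :
    inertia (G \ C) + finrank ℝ F ≤ inertia G := by
  classical
  let K : ((V → ℝ) × F) →ₗ[ℝ] (V → ℝ) :=
    { toFun := fun p w => if w ∈ C.support then J p.2 w else p.1 w
      map_add' := by
        intro p q
        ext w
        simp only [Prod.fst_add, Prod.snd_add, Pi.add_apply, map_add]
        split_ifs <;> rfl
      map_smul' := by
        intro c p
        ext w
        simp only [Prod.smul_fst, Prod.smul_snd, Pi.smul_apply, map_smul, RingHom.id_apply]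
        split_ifs <;> rfl }
  have hK : ∀ x t w, K (x, t) w = if w ∈ C.support then J t w else x w := fun _ _ _ => rfl
  refine inertia_add_le K (fun t => adjForm C (J t)) hJ (by simp) fun x t => ?_
  rw [adjForm_sdiff hC]
  congr 1
  · refine adjForm_congr _ fun a ha => ?_
    rw [hK, if_neg (Set.disjoint_left.mp hdisj ha)]
  · refine adjForm_congr _ fun a ha => ?_
    rw [hK, if_pos ha]

end Inertia

/-! ### Cycles as subgraphs on the full vertex type -/

section Cycles

variable {V : Type*}

/-- `g` runs around the cycle `C` of length `n`, periodically: `C` is regarded as a graph on all of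
`V`, whose edges join consecutive values of `g`. -/
def CycEnum (C : SimpleGraph V) (n : ℕ) (g : ℕ → V) : Prop :=
  3 ≤ n ∧ (∀ i j, g i = g j ↔ i ≡ j [MOD n]) ∧
    ∀ a b, C.Adj a b ↔ ∃ i, s(a, b) = s(g i, g (i + 1))

/-- `C`, as a graph on all of `V`, is a cycle of length `n` together with isolated vertices. The
cycles of `G` are the `C ≤ G` with this property, so that they can be compared with the cycles of
other graphs on `V`. -/
def IsCyc (C : SimpleGraph V) (n : ℕ) : Prop := ∃ g, CycEnum C n g

variable {C D G H : SimpleGraph V} {n m : ℕ} {g : ℕ → V}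

/-- A cycle can be enumerated from any of its vertices. -/
theorem CycEnum.rotate (h : CycEnum C n g) (k : ℕ) : CycEnum C n (fun i => g (i + k)) := by
  obtain ⟨h3, hinj, hadj⟩ := h
  refine ⟨h3, fun i j => ?_, fun a b => ?_⟩
  · rw [hinj]
    exact ⟨Nat.ModEq.add_right_cancel' k, Nat.ModEq.add_right k⟩
  · rw [hadj]
    constructor
    · rintro ⟨i, hi⟩
      -- shift the index by a multiple of the period that exceeds `k`
      have hk : k ≤ i + k * n := by nlinarith
      have e1 : g (i + k * n) = g i := (hinj _ _).2 (by simp [Nat.ModEq])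
      have e2 : g (i + k * n + 1) = g (i + 1) := (hinj _ _).2 (by
        have : i + k * n + 1 = i + 1 + k * n := by ring
        rw [this]; simp [Nat.ModEq])
      refine ⟨i + k * n - k, ?_⟩
      have e3 : i + k * n - k + k = i + k * n := by omega
      have e4 : i + k * n - k + 1 + k = i + k * n + 1 := by omega
      simp only [e3, e4, e1, e2, hi]
    · rintro ⟨i, hi⟩
      refine ⟨i + k, ?_⟩
      have e4 : i + 1 + k = i + k + 1 := by omega
      simpa only [e4] using hi

theorem CycEnum.mem_support (h : CycEnum C n g) {a : V} : a ∈ C.support ↔ ∃ i, g i = a := by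
  obtain ⟨-, -, hadj⟩ := h
  constructor
  · rintro ⟨b, hb⟩
    obtain ⟨i, hi⟩ := (hadj a b).1 hb
    rcases Sym2.eq_iff.1 hi with ⟨h1, -⟩ | ⟨h1, -⟩
    · exact ⟨i, h1.symm⟩
    · exact ⟨i + 1, h1.symm⟩
  · rintro ⟨i, rfl⟩
    exact ⟨g (i + 1), (hadj _ _).2 ⟨i, rfl⟩⟩

theorem CycEnum.apply_mod (h : CycEnum C n g) (i : ℕ) : g (i % n) = g i :=
  (h.2.1 _ _).2 (Nat.mod_modEq i n)

theorem CycEnum.mem_support_lt (h : CycEnum C n g) {a : V} :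
    a ∈ C.support ↔ ∃ i < n, g i = a := by
  have h3 := h.1
  rw [h.mem_support]
  constructor
  · rintro ⟨i, rfl⟩
    exact ⟨i % n, Nat.mod_lt _ (by omega), h.apply_mod i⟩
  · rintro ⟨i, -, hi⟩
    exact ⟨i, hi⟩

theorem CycEnum.inj_lt (h : CycEnum C n g) {i j : ℕ} (hi : i < n) (hj : j < n)
    (hij : g i = g j) : i = j :=
  Nat.ModEq.eq_of_lt_of_lt ((h.2.1 _ _).1 hij) hi hj

theorem IsCyc.exists_enum_zero (h : IsCyc C n) {x : V} (hx : x ∈ C.support) :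
    ∃ g, CycEnum C n g ∧ g 0 = x := by
  obtain ⟨g, hg⟩ := h
  obtain ⟨k, rfl⟩ := hg.mem_support.1 hx
  exact ⟨_, hg.rotate k, by simp⟩

theorem IsCyc.exists_enum_one (h : IsCyc C n) {x : V} (hx : x ∈ C.support) :
    ∃ g, CycEnum C n g ∧ g 1 = x := by
  obtain ⟨g, hg, rfl⟩ := h.exists_enum_zero hx
  have h3 := hg.1
  refine ⟨_, hg.rotate (n - 1), ?_⟩
  have : 1 + (n - 1) = n := by omega
  simp only [this]
  exact (hg.2.1 _ _).2 (by simp [Nat.ModEq])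

theorem CycEnum.adj_succ (h : CycEnum C n g) (i : ℕ) : C.Adj (g i) (g (i + 1)) :=
  (h.2.2 _ _).2 ⟨i, rfl⟩

theorem CycEnum.adj_one_iff (h : CycEnum C n g) (z : V) :
    C.Adj (g 1) z ↔ z = g 0 ∨ z = g 2 := by
  constructor
  · intro hz
    obtain ⟨i, hi⟩ := (h.2.2 _ _).1 hz
    rcases Sym2.eq_iff.1 hi with ⟨h1, rfl⟩ | ⟨h1, rfl⟩
    · right
      exact (h.2.1 _ _).2 (((h.2.1 _ _).1 h1).symm.add_right 1)
    · left
      refine (h.2.1 _ _).2 (Nat.ModEq.add_right_cancel' 1 ((h.2.1 _ _).1 h1).symm)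
  · rintro (rfl | rfl)
    · exact (h.adj_succ 0).symm
    · exact h.adj_succ 1

theorem IsCyc.exists_two_neighbors (h : IsCyc C n) {x : V} (hx : x ∈ C.support) :
    ∃ p q, p ≠ q ∧ ∀ z, C.Adj x z ↔ z = p ∨ z = q := by
  obtain ⟨g, hg, rfl⟩ := h.exists_enum_one hx
  have h3 := hg.1
  refine ⟨g 0, g 2, fun h02 => ?_, hg.adj_one_iff⟩
  have := hg.inj_lt (by omega) (by omega) h02
  omega

/-- Deleting the edge from `g 0` to `g 1` leaves the path `g 1, …, g n`. -/
theorem CycEnum.reachable_deleteEdges (h : CycEnum C n g) (j : ℕ) (hj : j < n) :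
    (C.deleteEdges {s(g 0, g 1)}).Reachable (g 1) (g (j + 1)) := by
  have h3 := h.1
  induction j with
  | zero => exact SimpleGraph.Reachable.refl _
  | succ j ih =>
    refine (ih (by omega)).trans (SimpleGraph.Adj.reachable ?_)
    rw [SimpleGraph.deleteEdges_adj]
    refine ⟨h.adj_succ _, fun hmem => ?_⟩
    rcases Sym2.eq_iff.1 (Set.mem_singleton_iff.1 hmem) with ⟨h1, -⟩ | ⟨h1, h2⟩
    · have := h.inj_lt (by omega) (by omega) h1
      omega
    · have := h.inj_lt (by omega) (by omega) h1
      have h5 : j + 1 + 1 = 2 := by omega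
      rw [h5] at h2
      have := h.inj_lt (by omega) (by omega) h2
      omega

theorem IsCyc.reachable_deleteEdges (h : IsCyc C n) {a b : V} (hab : C.Adj a b) {x y : V}
    (hx : x ∈ C.support) (hy : y ∈ C.support) :
    (C.deleteEdges {s(a, b)}).Reachable x y := by
  obtain ⟨g, hg⟩ := h
  obtain ⟨i, hi⟩ := (hg.2.2 _ _).1 hab
  have hr := hg.rotate i
  have key : ∀ z ∈ C.support, (C.deleteEdges {s(a, b)}).Reachable (g (1 + i)) z := by
    intro z hz
    obtain ⟨j, hj, rfl⟩ := hr.mem_support_lt.1 hz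
    have h3 := hr.1
    rw [hi]
    have e0 : 0 + i = i := by omega
    have e1 : 1 + i = i + 1 := by omega
    rcases Nat.eq_zero_or_pos j with rfl | hj0
    · have := hr.reachable_deleteEdges (n - 1) (by omega)
      have e2 : g (n - 1 + 1 + i) = g (0 + i) :=
        (hr.2.1 (n - 1 + 1) 0).2 (by rw [show n - 1 + 1 = n by omega]; simp [Nat.ModEq])
      simpa only [e2, e0, e1] using this
    · have := hr.reachable_deleteEdges (j - 1) (by omega)
      rw [show j - 1 + 1 = j by omega] at this
      simpa only [e0, e1] using this
  exact (key x hx).symm.trans (key y hy)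

theorem IsCyc.reachable (h : IsCyc C n) {x y : V} (hx : x ∈ C.support) (hy : y ∈ C.support) :
    C.Reachable x y := by
  obtain ⟨z, hz⟩ := hx
  exact (h.reachable_deleteEdges hz ⟨z, hz⟩ hy).mono (SimpleGraph.deleteEdges_le _)

/-- A set that meets `C.support` and is closed under `C`-adjacency contains `C.support`. -/
theorem IsCyc.support_subset (h : IsCyc C n) {S : Set V} {x : V} (hx : x ∈ C.support)
    (hxS : x ∈ S) (hS : ∀ a b, a ∈ S → C.Adj a b → b ∈ S) : C.support ⊆ S := by
  intro y hy
  have := h.reachable hx hy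
  rw [SimpleGraph.reachable_iff_reflTransGen] at this
  induction this with
  | refl => exact hxS
  | @tail b c _ hbc ih => exact hS b c (ih ⟨c, hbc⟩) hbc

/-- Cycles through a common vertex that agree locally are equal, since cycles are connected and
2-regular. -/
theorem IsCyc.eq_of_forall_adj (hC : IsCyc C n) (hD : IsCyc D m) {x : V} (hxC : x ∈ C.support)
    (hxD : x ∈ D.support)
    (h : ∀ a ∈ C.support, a ∈ D.support → ∀ z, C.Adj a z → D.Adj a z) : C = D := by
  have h' : ∀ a ∈ C.support, a ∈ D.support → ∀ z, D.Adj a z → C.Adj a z := by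
    intro a ha ha' z hz
    obtain ⟨p, q, hpq, h1⟩ := hC.exists_two_neighbors ha
    obtain ⟨p', q', -, h2⟩ := hD.exists_two_neighbors ha'
    have h3 := (h2 p).1 (h a ha ha' p ((h1 p).2 (Or.inl rfl)))
    have h4 := (h2 q).1 (h a ha ha' q ((h1 q).2 (Or.inr rfl)))
    have h5 := (h2 z).1 hz
    rw [h1]
    grind
  have hsub : C.support ⊆ C.support ∩ D.support := hC.support_subset hxC ⟨hxC, hxD⟩ (by
    rintro a b ⟨ha, ha'⟩ hab
    exact ⟨⟨a, hab.symm⟩, ⟨a, (h a ha ha' b hab).symm⟩⟩)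
  have hsub' : D.support ⊆ C.support ∩ D.support := hD.support_subset hxD ⟨hxC, hxD⟩ (by
    rintro a b ⟨ha, ha'⟩ hab
    exact ⟨⟨a, (h' a ha ha' b hab).symm⟩, ⟨a, hab.symm⟩⟩)
  ext a b
  constructor
  · intro hab
    exact h a ⟨b, hab⟩ (hsub ⟨b, hab⟩).2 b hab
  · intro hab
    exact h' a (hsub' ⟨b, hab⟩).1 ⟨b, hab⟩ b hab

theorem IsCyc.eq_of_le (hC : IsCyc C n) (hD : IsCyc D m) (h : C ≤ D) : C = D := by
  obtain ⟨g, hg⟩ := id hC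
  have hx : g 0 ∈ C.support := hg.mem_support.2 ⟨0, rfl⟩
  exact hC.eq_of_forall_adj hD hx (SimpleGraph.support_mono h hx) fun a _ _ z hz => h hz

theorem CycEnum.support_eq [DecidableEq V] (h : CycEnum C n g) :
    C.support = ((Finset.range n).image g : Finset V) := by
  ext a
  simp [h.mem_support_lt]

theorem CycEnum.card_image [DecidableEq V] (h : CycEnum C n g) :
    ((Finset.range n).image g).card = n := by
  rw [Finset.card_image_of_injOn, Finset.card_range]
  intro i hi j hj hij
  exact h.inj_lt (by simpa using hi) (by simpa using hj) hij

theorem IsCyc.ncard_support (h : IsCyc C n) : C.support.ncard = n := by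
  classical
  obtain ⟨g, hg⟩ := h
  rw [hg.support_eq, Set.ncard_coe_finset, hg.card_image]

theorem IsCyc.length_unique (h : IsCyc C n) (h' : IsCyc C m) : n = m :=
  h.ncard_support.symm.trans h'.ncard_support

theorem isCyc_of_isCycle {v : V} (p : G.Walk v v) (hp : p.IsCycle) :
    IsCyc p.toSubgraph.spanningCoe p.length := by
  have h3 := hp.three_le_length
  have hlt : ∀ i, i % p.length < p.length := fun i => Nat.mod_lt _ (by omega)
  -- one step along the walk, from index `i < p.length`
  have hsucc : ∀ i, p.getVert ((i + 1) % p.length) = p.getVert (i % p.length + 1) := by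
    intro i
    have := hlt i
    rw [← Nat.mod_add_mod]
    rcases Nat.lt_or_ge (i % p.length + 1) p.length with h | h
    · rw [Nat.mod_eq_of_lt h]
    · have h' : i % p.length + 1 = p.length := by omega
      rw [h', Nat.mod_self]
      simp
  refine ⟨fun i => p.getVert (i % p.length), h3, fun i j => ?_, fun a b => ?_⟩
  · constructor
    · intro h
      have h1 := hlt i
      have h2 := hlt j
      exact hp.getVert_injOn' (by simp; omega) (by simp; omega) h
    · intro h
      simp only
      rw [show i % p.length = j % p.length from h]
  · rw [SimpleGraph.Subgraph.spanningCoe_adj, SimpleGraph.Walk.toSubgraph_adj_iff]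
    constructor
    · rintro ⟨i, hi, hil⟩
      refine ⟨i, ?_⟩
      simp only [hsucc]
      rw [Nat.mod_eq_of_lt hil, hi]
    · rintro ⟨i, hi⟩
      simp only [hsucc] at hi
      exact ⟨i % p.length, hi.symm, hlt i⟩

/-- The graph formed by the edges of `G` that lie on a cycle. Its support is the set of cyclic
vertices. -/
def core (G : SimpleGraph V) : SimpleGraph V where
  Adj a b := ∃ C n, IsCyc C n ∧ C ≤ G ∧ C.Adj a b
  symm := ⟨fun _ _ ⟨C, n, hC, hG, h⟩ => ⟨C, n, hC, hG, h.symm⟩⟩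
  loopless := ⟨fun _ ⟨_, _, _, _, h⟩ => h.ne rfl⟩

theorem core_le (G : SimpleGraph V) : core G ≤ G := fun _ _ ⟨_, _, _, hG, h⟩ => hG h

theorem core_mono (h : H ≤ G) : core H ≤ core G :=
  fun _ _ ⟨C, n, hC, hG, h'⟩ => ⟨C, n, hC, hG.trans h, h'⟩

theorem IsCyc.le_core (hC : IsCyc C n) (h : C ≤ G) : C ≤ core G :=
  fun _ _ h' => ⟨C, n, hC, h, h'⟩

theorem mem_support_core {x : V} :
    x ∈ (core G).support ↔ ∃ C n, IsCyc C n ∧ C ≤ G ∧ x ∈ C.support :=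
  ⟨fun ⟨b, C, n, hC, hG, h⟩ => ⟨C, n, hC, hG, b, h⟩,
    fun ⟨C, n, hC, hG, b, h⟩ => ⟨b, C, n, hC, hG, h⟩⟩

/-- The edges on cycles are those that are not bridges. -/
theorem core_adj_iff {a b : V} :
    (core G).Adj a b ↔ G.Adj a b ∧ (G.deleteEdges {s(a, b)}).Reachable a b := by
  constructor
  · rintro ⟨C, n, hC, hG, h⟩
    refine ⟨hG h, (hC.reachable_deleteEdges h ⟨b, h⟩ ⟨a, h.symm⟩).mono ?_⟩
    intro x y hxy
    rw [SimpleGraph.deleteEdges_adj] at hxy ⊢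
    exact ⟨hG hxy.1, hxy.2⟩
  · intro h
    obtain ⟨u, p, hp, he⟩ := SimpleGraph.adj_and_reachable_delete_edges_iff_exists_cycle.1 h
    refine ⟨_, _, isCyc_of_isCycle p hp, p.toSubgraph.spanningCoe_le, ?_⟩
    rw [SimpleGraph.Subgraph.spanningCoe_adj]
    exact (SimpleGraph.Walk.mem_edges_toSubgraph p).2 he

/-- An edge of `C` is no bridge of `C`, so some closed walk inside `C` is a cycle through it; this
walk covers all of `C`, because no cycle is properly contained in another. -/
theorem IsCyc.exists_walk (hC : IsCyc C n) (hG : C ≤ G) :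
    ∃ (v : V) (p : G.Walk v v), p.IsCycle ∧ p.toSubgraph.spanningCoe = C ∧ p.length = n := by
  obtain ⟨g, hg⟩ := id hC
  have hcore : (core C).Adj (g 0) (g 1) := ⟨C, n, hC, le_rfl, hg.adj_succ 0⟩
  obtain ⟨u, p, hp, -⟩ := SimpleGraph.adj_and_reachable_delete_edges_iff_exists_cycle.1
    (core_adj_iff.1 hcore)
  have h1 := isCyc_of_isCycle (p.mapLe hG) (hp.mapLe hG)
  have h2 := isCyc_of_isCycle p hp
  have h3 := h2.eq_of_le hC p.toSubgraph.spanningCoe_le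
  have h4 : (p.mapLe hG).toSubgraph.spanningCoe = p.toSubgraph.spanningCoe := by
    ext a b
    simp [SimpleGraph.Walk.toSubgraph_adj_iff]
  refine ⟨u, p.mapLe hG, hp.mapLe hG, h4.trans h3, ?_⟩
  rw [h4, h3] at h1
  exact h1.length_unique hC

end Cycles

/-! ### Matchings as sets of edges -/

section Matchings

variable {V W : Type*} {G G' G₁ G₂ : SimpleGraph V}

/-- A matching of `G`, given as a finite set of pairwise disjoint edges. -/
def IsMatchSet (G : SimpleGraph V) (M : Finset (Sym2 V)) : Prop :=
  (∀ e ∈ M, e ∈ G.edgeSet) ∧ ∀ e ∈ M, ∀ f ∈ M, ∀ v, v ∈ e → v ∈ f → e = f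

theorem IsMatchSet.exists_subgraph {M : Finset (Sym2 V)} (h : IsMatchSet G M) :
    ∃ S : G.Subgraph, S.IsMatching ∧ S.edgeSet.ncard = M.card := by
  obtain ⟨h1, h2⟩ := h
  let S : G.Subgraph :=
    { verts := {v | ∃ e ∈ M, v ∈ e}
      Adj := fun a b => s(a, b) ∈ M
      adj_sub := fun {a b} hab => h1 _ hab
      edge_vert := fun {a b} hab => ⟨_, hab, Sym2.mem_mk_left a b⟩
      symm := ⟨fun a b hab => by rwa [Sym2.eq_swap]⟩ }
  refine ⟨S, ?_, ?_⟩
  · rintro v ⟨e, he, hv⟩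
    obtain ⟨w, rfl⟩ := hv
    refine ⟨w, he, fun y hy => ?_⟩
    have := h2 _ hy _ he v (Sym2.mem_mk_left _ _) (Sym2.mem_mk_left _ _)
    exact Sym2.congr_right.1 this
  · have : S.edgeSet = (M : Set (Sym2 V)) := by
      ext e
      induction e with
      | _ a b => rfl
    rw [this, Set.ncard_coe_finset]

theorem exists_isMatchSet_of_isMatching [Finite V] {S : G.Subgraph} (hS : S.IsMatching) :
    ∃ M, IsMatchSet G M ∧ M.card = S.edgeSet.ncard := by
  have hfin : S.edgeSet.Finite := Set.toFinite _
  refine ⟨hfin.toFinset, ⟨?_, ?_⟩, (Set.ncard_eq_toFinset_card _ hfin).symm⟩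
  · intro e he
    exact S.edgeSet_subset (hfin.mem_toFinset.1 he)
  · intro e he f hf v hve hvf
    rw [hfin.mem_toFinset] at he hf
    obtain ⟨a, rfl⟩ := hve
    obtain ⟨b, rfl⟩ := hvf
    have ha : S.Adj v a := he
    have hb : S.Adj v b := hf
    rw [(hS (S.edge_vert ha)).unique ha hb]

theorem isMatchSet_card_le [Finite V] {M : Finset (Sym2 V)} (h : IsMatchSet G M) :
    M.card ≤ matchingNumber G := by
  refine le_csSup ⟨Nat.card (Sym2 V), ?_⟩ h.exists_subgraph
  rintro k ⟨S, -, rfl⟩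
  exact Set.ncard_le_card _

theorem exists_isMatchSet [Finite V] (G : SimpleGraph V) :
    ∃ M, IsMatchSet G M ∧ M.card = matchingNumber G := by
  have hne : {k : ℕ | ∃ M : G.Subgraph, M.IsMatching ∧ M.edgeSet.ncard = k}.Nonempty :=
    ⟨0, IsMatchSet.exists_subgraph (M := ∅) ⟨by simp, by simp⟩⟩
  have hmem : matchingNumber G ∈
      {k : ℕ | ∃ M : G.Subgraph, M.IsMatching ∧ M.edgeSet.ncard = k} := by
    refine Nat.sSup_mem hne ⟨Nat.card (Sym2 V), ?_⟩
    rintro k ⟨S, -, rfl⟩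
    exact Set.ncard_le_card _
  obtain ⟨S, hS, hcard⟩ := hmem
  obtain ⟨M, hM, hM'⟩ := exists_isMatchSet_of_isMatching hS
  exact ⟨M, hM, hM'.trans hcard⟩

/-- A homomorphism that is injective on the non-isolated vertices carries matchings over. -/
theorem matchingNumber_le_of_injOn [Finite V] [Finite W] {G : SimpleGraph V} {H : SimpleGraph W}
    (f : V → W) (hf : Set.InjOn f G.support) (hadj : ∀ a b, G.Adj a b → H.Adj (f a) (f b)) :
    matchingNumber G ≤ matchingNumber H := by
  classical
  obtain ⟨M, ⟨h1, h2⟩, hM⟩ := exists_isMatchSet G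
  have hsupp : ∀ e ∈ M, ∀ v ∈ e, v ∈ G.support := by
    rintro e he v ⟨w, rfl⟩
    exact ⟨w, h1 _ he⟩
  -- edges with a common endpoint after applying `f` had one before
  have key : ∀ e ∈ M, ∀ e' ∈ M, ∀ w, w ∈ Sym2.map f e → w ∈ Sym2.map f e' → e = e' := by
    intro e he e' he' w hw hw'
    obtain ⟨v, hv, rfl⟩ := Sym2.mem_map.1 hw
    obtain ⟨v', hv', hvv⟩ := Sym2.mem_map.1 hw'
    have := hf (hsupp _ he' _ hv') (hsupp _ he _ hv) hvv
    subst this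
    exact h2 _ he _ he' _ hv hv'
  have hinj : Set.InjOn (Sym2.map f) M := by
    intro e he e' he' hee
    induction e with
    | _ a b => exact key _ he _ he' (f a) (by simp) (hee ▸ by simp)
  rw [← hM, ← Finset.card_image_of_injOn hinj]
  refine isMatchSet_card_le ⟨?_, ?_⟩
  · intro e he
    obtain ⟨d, hd, rfl⟩ := Finset.mem_image.1 he
    induction d with
    | _ a b => exact hadj a b (h1 _ hd)
  · intro e he e' he' w hw hw'
    obtain ⟨d, hd, rfl⟩ := Finset.mem_image.1 he
    obtain ⟨d', hd', rfl⟩ := Finset.mem_image.1 he'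
    rw [key d hd d' hd' w hw hw']

variable [Finite V]

theorem matchingNumber_mono (h : G ≤ G') : matchingNumber G ≤ matchingNumber G' :=
  matchingNumber_le_of_injOn id Function.injective_id.injOn fun _ _ hab => h hab

theorem matchingNumber_le_add (h : ∀ a b, G.Adj a b → G₁.Adj a b ∨ G₂.Adj a b) :
    matchingNumber G ≤ matchingNumber G₁ + matchingNumber G₂ := by
  classical
  obtain ⟨M, ⟨h1, h2⟩, hM⟩ := exists_isMatchSet G
  rw [← hM, ← Finset.card_filter_add_card_filter_not (fun e => e ∈ G₁.edgeSet)]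
  refine Nat.add_le_add (isMatchSet_card_le ⟨?_, ?_⟩) (isMatchSet_card_le ⟨?_, ?_⟩)
  · intro e he
    exact (Finset.mem_filter.1 he).2
  · intro e he f hf
    exact h2 e (Finset.mem_filter.1 he).1 f (Finset.mem_filter.1 hf).1
  · intro e he
    obtain ⟨he, he'⟩ := Finset.mem_filter.1 he
    induction e with
    | _ a b => exact (h a b (h1 _ he)).resolve_left he'
  · intro e he f hf
    exact h2 e (Finset.mem_filter.1 he).1 f (Finset.mem_filter.1 hf).1

theorem matchingNumber_le_card_of_cover {U : Finset V} (h : ∀ a b, G.Adj a b → a ∈ U ∨ b ∈ U) :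
    matchingNumber G ≤ U.card := by
  classical
  obtain ⟨M, ⟨h1, h2⟩, hM⟩ := exists_isMatchSet G
  have hex : ∀ e ∈ M, ∃ v ∈ U, v ∈ e := by
    intro e he
    induction e with
    | _ a b =>
      rcases h a b (h1 _ he) with h | h
      · exact ⟨a, h, Sym2.mem_mk_left _ _⟩
      · exact ⟨b, h, Sym2.mem_mk_right _ _⟩
  rcases M.eq_empty_or_nonempty with rfl | ⟨e₀, he₀⟩
  · simp [← hM]
  obtain ⟨v₀, -⟩ := hex e₀ he₀
  have : Nonempty V := ⟨v₀⟩
  choose! φ hφU hφ using hex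
  rw [← hM]
  refine Finset.card_le_card_of_injOn φ hφU fun e he f hf hef => ?_
  exact h2 e he f hf (φ e) (hφ e he) (hef ▸ hφ f hf)

theorem matchingNumber_le_add_card {U : Finset V}
    (h : ∀ a b, G.Adj a b → G'.Adj a b ∨ a ∈ U ∨ b ∈ U) :
    matchingNumber G ≤ matchingNumber G' + U.card := by
  classical
  refine (matchingNumber_le_add (G₁ := G') (G₂ := G \ G') fun a b hab => ?_).trans
    (Nat.add_le_add_left (matchingNumber_le_card_of_cover fun a b hab => ?_) _)
  · by_cases h' : G'.Adj a b
    · exact Or.inl h'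
    · exact Or.inr ⟨hab, h'⟩
  · exact (h a b hab.1).resolve_left hab.2

theorem matchingNumber_le_deleteIncidenceSet (G : SimpleGraph V) (x : V) :
    matchingNumber G ≤ matchingNumber (G.deleteIncidenceSet x) + 1 := by
  classical
  refine matchingNumber_le_add_card (U := {x}) fun a b hab => ?_
  rw [SimpleGraph.deleteIncidenceSet_adj]
  simp only [Finset.mem_singleton]
  tauto

theorem matchingNumber_add_le (h₁ : G₁ ≤ G) (h₂ : G₂ ≤ G)
    (hd : Disjoint G₁.support G₂.support) :
    matchingNumber G₁ + matchingNumber G₂ ≤ matchingNumber G := by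
  classical
  obtain ⟨M, ⟨h1, h2⟩, hM⟩ := exists_isMatchSet G₁
  obtain ⟨N, ⟨h3, h4⟩, hN⟩ := exists_isMatchSet G₂
  have hsM : ∀ e ∈ M, ∀ v ∈ e, v ∈ G₁.support := by
    rintro e he v ⟨w, rfl⟩
    exact ⟨w, h1 _ he⟩
  have hsN : ∀ e ∈ N, ∀ v ∈ e, v ∈ G₂.support := by
    rintro e he v ⟨w, rfl⟩
    exact ⟨w, h3 _ he⟩
  have hdisj : Disjoint M N := by
    rw [Finset.disjoint_left]
    intro e he he'
    induction e with
    | _ a b => exact Set.disjoint_left.1 hd (hsM _ he a (by simp)) (hsN _ he' a (by simp))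
  rw [← hM, ← hN, ← Finset.card_union_of_disjoint hdisj]
  refine isMatchSet_card_le ⟨?_, ?_⟩
  · intro e he
    rcases Finset.mem_union.1 he with he | he
    · exact SimpleGraph.edgeSet_mono h₁ (h1 e he)
    · exact SimpleGraph.edgeSet_mono h₂ (h3 e he)
  · intro e he f hf v hve hvf
    rcases Finset.mem_union.1 he with he | he <;> rcases Finset.mem_union.1 hf with hf | hf
    · exact h2 e he f hf v hve hvf
    · exact (Set.disjoint_left.1 hd (hsM e he v hve) (hsN f hf v hvf)).elim
    · exact (Set.disjoint_left.1 hd (hsM f hf v hvf) (hsN e he v hve)).elim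
    · exact h4 e he f hf v hve hvf

theorem matchingNumber_add_one_le (h : G' ≤ G) {x y : V} (hxy : G.Adj x y)
    (hx : x ∉ G'.support) (hy : y ∉ G'.support) :
    matchingNumber G' + 1 ≤ matchingNumber G := by
  have hle : SimpleGraph.edge x y ≤ G := by
    rw [SimpleGraph.edge_le_iff]
    exact Or.inr hxy
  have hone : 1 ≤ matchingNumber (SimpleGraph.edge x y) := by
    refine le_of_eq_of_le (Finset.card_singleton s(x, y)).symm (isMatchSet_card_le ⟨?_, ?_⟩)
    · intro e he
      rw [Finset.mem_singleton.1 he, SimpleGraph.mem_edgeSet, SimpleGraph.edge_adj]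
      simp [hxy.ne]
    · intro e he f hf v _ _
      rw [Finset.mem_singleton.1 he, Finset.mem_singleton.1 hf]
  refine le_trans (Nat.add_le_add_left hone _) (matchingNumber_add_le h hle ?_)
  rw [Set.disjoint_left]
  rintro a ha ⟨b, hb⟩
  replace hb := (SimpleGraph.edge_adj x y a b).1 hb
  rcases hb.1 with ⟨rfl, -⟩ | ⟨rfl, -⟩
  · exact hx ha
  · exact hy ha

theorem two_mul_matchingNumber_le {S : Finset V} (h : ∀ a b, G.Adj a b → a ∈ S) :
    2 * matchingNumber G ≤ S.card := by
  classical
  obtain ⟨M, ⟨h1, h2⟩, hM⟩ := exists_isMatchSet G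
  have hcard : (M.biUnion Sym2.toFinset).card = 2 * M.card := by
    rw [Finset.card_biUnion]
    · rw [Finset.sum_congr rfl (g := fun _ => 2)]
      · simp [mul_comm]
      · intro e he
        exact Sym2.card_toFinset_of_not_isDiag e (G.not_isDiag_of_mem_edgeSet (h1 e he))
    · intro e he f hf hef
      refine Finset.disjoint_left.2 fun v hv hv' => ?_
      rw [Sym2.mem_toFinset] at hv hv'
      exact hef (h2 e he f hf v hv hv')
  rw [← hM, ← hcard]
  refine Finset.card_le_card fun v hv => ?_
  obtain ⟨e, he, hv⟩ := Finset.mem_biUnion.1 hv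
  rw [Sym2.mem_toFinset] at hv
  obtain ⟨w, rfl⟩ := hv
  exact h v w (h1 _ he)

/-- Every second edge of the path `g o, g (o + 1), …, g (o + 2 k - 1)` gives a matching of size
`k`. -/
theorem le_matchingNumber_of_path {g : ℕ → V} {o k : ℕ}
    (hinj : ∀ i j, i < 2 * k + o → j < 2 * k + o → g i = g j → i = j)
    (hadj : ∀ i < k, G.Adj (g (2 * i + o)) (g (2 * i + 1 + o))) : k ≤ matchingNumber G := by
  classical
  have key : ∀ i < k, ∀ j < k, ∀ v, v ∈ s(g (2 * i + o), g (2 * i + 1 + o)) →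
      v ∈ s(g (2 * j + o), g (2 * j + 1 + o)) → i = j := by
    intro i hi j hj v hv hv'
    rcases Sym2.mem_iff.1 hv with rfl | rfl <;> rcases Sym2.mem_iff.1 hv' with h | h
    all_goals
      have := hinj _ _ (by omega) (by omega) h
      omega
  have hinj' : Set.InjOn (fun i => s(g (2 * i + o), g (2 * i + 1 + o))) (Finset.range k) := by
    intro i hi j hj hij
    simp only [Finset.coe_range, Set.mem_Iio] at hi hj
    exact key i hi j hj (g (2 * i + o)) (by simp) (by
      have : s(g (2 * i + o), g (2 * i + 1 + o)) = s(g (2 * j + o), g (2 * j + 1 + o)) := hij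
      rw [← this]; simp)
  have := Finset.card_image_of_injOn hinj'
  rw [Finset.card_range] at this
  refine le_of_eq_of_le this.symm (isMatchSet_card_le ⟨?_, ?_⟩)
  · intro e he
    obtain ⟨i, hi, rfl⟩ := Finset.mem_image.1 he
    exact hadj i (Finset.mem_range.1 hi)
  · intro e he f hf v hve hvf
    obtain ⟨i, hi, rfl⟩ := Finset.mem_image.1 he
    obtain ⟨j, hj, rfl⟩ := Finset.mem_image.1 hf
    rw [key i (Finset.mem_range.1 hi) j (Finset.mem_range.1 hj) v hve hvf]

theorem IsCyc.le_matchingNumber {n : ℕ} (h : IsCyc G n) : n / 2 ≤ matchingNumber G := by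
  obtain ⟨g, hg⟩ := h
  refine le_matchingNumber_of_path (g := g) (o := 0) (fun i j hi hj => ?_) fun i _ => ?_
  · exact hg.inj_lt (by omega) (by omega)
  · exact hg.adj_succ _

theorem IsCyc.le_matchingNumber_deleteIncidenceSet {n : ℕ} (h : IsCyc G n) {x : V}
    (hx : x ∈ G.support) : (n - 1) / 2 ≤ matchingNumber (G.deleteIncidenceSet x) := by
  obtain ⟨g, hg, rfl⟩ := h.exists_enum_zero hx
  have h3 := hg.1
  refine le_matchingNumber_of_path (g := g) (o := 1) (fun i j hi hj => ?_) fun i hi => ?_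
  · exact hg.inj_lt (by omega) (by omega)
  · rw [SimpleGraph.deleteIncidenceSet_adj]
    refine ⟨hg.adj_succ _, fun h0 => ?_, fun h0 => ?_⟩
    · have := hg.inj_lt (by omega) (by omega) h0
      omega
    · have := hg.inj_lt (by omega) (by omega) h0
      omega

end Matchings

/-! ### The cyclomatic number under deletion of edges -/

section Cyclomatic

variable {V : Type*} {C G H : SimpleGraph V} {n : ℕ}

/-- A walk that uses the edge `ab` can be cut at its first and last use of that edge. -/
theorem reachable_deleteEdges_or {a b x y : V} (h : G.Reachable x y) :
    (G.deleteEdges {s(a, b)}).Reachable x y ∨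
      ((G.deleteEdges {s(a, b)}).Reachable x a ∧ (G.deleteEdges {s(a, b)}).Reachable b y) ∨
      ((G.deleteEdges {s(a, b)}).Reachable x b ∧ (G.deleteEdges {s(a, b)}).Reachable a y) := by
  rw [SimpleGraph.reachable_iff_reflTransGen] at h
  induction h with
  | refl => exact Or.inl (SimpleGraph.Reachable.refl _)
  | @tail y z _ hyz ih =>
    by_cases he : s(y, z) = s(a, b)
    · rcases Sym2.eq_iff.1 he with ⟨rfl, rfl⟩ | ⟨rfl, rfl⟩
      · rcases ih with h | ⟨h, -⟩ | ⟨h, -⟩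
        · exact Or.inr (Or.inl ⟨h, SimpleGraph.Reachable.refl _⟩)
        · exact Or.inr (Or.inl ⟨h, SimpleGraph.Reachable.refl _⟩)
        · exact Or.inl h
      · rcases ih with h | ⟨h, -⟩ | ⟨h, -⟩
        · exact Or.inr (Or.inr ⟨h, SimpleGraph.Reachable.refl _⟩)
        · exact Or.inl h
        · exact Or.inr (Or.inr ⟨h, SimpleGraph.Reachable.refl _⟩)
    · have hadj : (G.deleteEdges {s(a, b)}).Reachable y z := by
        refine SimpleGraph.Adj.reachable ?_
        rw [SimpleGraph.deleteEdges_adj]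
        exact ⟨hyz, he⟩
      rcases ih with h | ⟨h, h'⟩ | ⟨h, h'⟩
      · exact Or.inl (h.trans hadj)
      · exact Or.inr (Or.inl ⟨h, h'.trans hadj⟩)
      · exact Or.inr (Or.inr ⟨h, h'.trans hadj⟩)

theorem card_connectedComponent_of_reachable {a b : V}
    (h : (G.deleteEdges {s(a, b)}).Reachable a b) :
    Nat.card (G.deleteEdges {s(a, b)}).ConnectedComponent = Nat.card G.ConnectedComponent := by
  refine Nat.card_eq_of_bijective
    (SimpleGraph.ConnectedComponent.map (SimpleGraph.Hom.ofLE (SimpleGraph.deleteEdges_le _)))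
    ⟨?_, SimpleGraph.ConnectedComponent.surjective_map_ofLE _⟩
  intro c d
  induction c using SimpleGraph.ConnectedComponent.ind with | _ x
  induction d using SimpleGraph.ConnectedComponent.ind with | _ y
  intro hxy
  simp only [SimpleGraph.ConnectedComponent.map_mk, SimpleGraph.ConnectedComponent.eq] at hxy ⊢
  rcases reachable_deleteEdges_or (a := a) (b := b) hxy with h1 | ⟨h1, h2⟩ | ⟨h1, h2⟩
  · exact h1
  · exact (h1.trans h).trans h2
  · exact (h1.trans h.symm).trans h2

theorem le_deleteEdges (h : H ≤ G) {a b : V} (hH : ¬ H.Adj a b) :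
    H ≤ G.deleteEdges {s(a, b)} := by
  intro x y hxy
  rw [SimpleGraph.deleteEdges_adj]
  refine ⟨h hxy, fun he => hH ?_⟩
  rw [← SimpleGraph.mem_edgeSet, ← Set.mem_singleton_iff.1 he]
  exact hxy

theorem exists_adj_of_le_of_ne (h : H ≤ G) (hne : H ≠ G) : ∃ a b, G.Adj a b ∧ ¬ H.Adj a b := by
  by_contra! hc
  exact hne (le_antisymm h fun a b hab => hc a b hab)

theorem cyclomaticNumber_bot : cyclomaticNumber (⊥ : SimpleGraph V) = 0 := by
  have h1 : Nat.card (⊥ : SimpleGraph V).ConnectedComponent = Nat.card V := by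
    refine (Nat.card_eq_of_bijective (⊥ : SimpleGraph V).connectedComponentMk ⟨?_, ?_⟩).symm
    · intro x y hxy
      have := SimpleGraph.ConnectedComponent.exact hxy
      simpa using this
    · intro c
      induction c using SimpleGraph.ConnectedComponent.ind with | _ x
      exact ⟨x, rfl⟩
  rw [cyclomaticNumber, h1]
  simp

theorem deleteIncidenceSet_le_deleteEdges (G : SimpleGraph V) (x y : V) :
    G.deleteIncidenceSet x ≤ G.deleteEdges {s(x, y)} :=
  le_deleteEdges (G.deleteIncidenceSet_le x) fun h =>
    (SimpleGraph.deleteIncidenceSet_adj.1 h).2.1 rfl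

theorem core_adj_deleteIncidenceSet_of_notMem {x : V} (h : x ∉ (core G).support) {a b : V}
    (hab : (core G).Adj a b) : (G.deleteIncidenceSet x).Adj a b := by
  rw [SimpleGraph.deleteIncidenceSet_adj]
  refine ⟨core_le G hab, ?_, ?_⟩
  · rintro rfl
    exact h ⟨b, hab⟩
  · rintro rfl
    exact h ⟨a, hab.symm⟩

variable [Finite V]

theorem card_connectedComponent_of_not_reachable {a b : V} (hab : G.Adj a b)
    (h : ¬ (G.deleteEdges {s(a, b)}).Reachable a b) :
    Nat.card (G.deleteEdges {s(a, b)}).ConnectedComponent =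
      Nat.card G.ConnectedComponent + 1 := by
  classical
  set G' := G.deleteEdges {s(a, b)} with hG'
  have hle : G' ≤ G := SimpleGraph.deleteEdges_le _
  let B : G'.ConnectedComponent := G'.connectedComponentMk b
  have hcard : Nat.card {c : G'.ConnectedComponent // c ≠ B} = Nat.card G.ConnectedComponent := by
    refine Nat.card_eq_of_bijective
      (fun c => SimpleGraph.ConnectedComponent.map (SimpleGraph.Hom.ofLE hle) c.1) ⟨?_, ?_⟩
    · rintro ⟨c, hc⟩ ⟨d, hd⟩
      induction c using SimpleGraph.ConnectedComponent.ind with | _ x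
      induction d using SimpleGraph.ConnectedComponent.ind with | _ y
      intro hxy
      simp only [SimpleGraph.ConnectedComponent.map_mk, SimpleGraph.ConnectedComponent.eq,
        Subtype.mk.injEq, B, ne_eq] at hxy hc hd ⊢
      rcases reachable_deleteEdges_or (a := a) (b := b) hxy with h1 | ⟨h1, h2⟩ | ⟨h1, h2⟩
      · exact h1
      · exact (hd h2.symm).elim
      · exact (hc h1).elim
    · intro d
      induction d using SimpleGraph.ConnectedComponent.ind with | _ x
      by_cases hx : G'.Reachable x b
      · refine ⟨⟨G'.connectedComponentMk a, fun h' => h ?_⟩, ?_⟩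
        · exact SimpleGraph.ConnectedComponent.exact h'
        · simp only [SimpleGraph.ConnectedComponent.map_mk, SimpleGraph.ConnectedComponent.eq]
          exact hab.reachable.trans (hx.mono hle).symm
      · exact ⟨⟨G'.connectedComponentMk x, fun h' =>
          hx (SimpleGraph.ConnectedComponent.exact h')⟩, rfl⟩
  rw [← hcard]
  have h2 : Nat.card {c : G'.ConnectedComponent // c ≠ B} =
      ({c | c ≠ B} : Set G'.ConnectedComponent).ncard := rfl
  have h3 : ({c | c ≠ B} : Set G'.ConnectedComponent) = {B}ᶜ := rfl
  rw [h2, h3]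
  have := Set.ncard_add_ncard_compl ({B} : Set G'.ConnectedComponent)
  rw [Set.ncard_singleton] at this
  omega

theorem card_edgeSet_deleteEdges {a b : V} (hab : G.Adj a b) :
    Nat.card (G.deleteEdges {s(a, b)}).edgeSet + 1 = Nat.card G.edgeSet := by
  rw [SimpleGraph.edgeSet_deleteEdges]
  exact Set.ncard_sdiff_singleton_add_one hab (Set.toFinite _)

theorem card_edgeSet_lt (h : H ≤ G) {a b : V} (hG : G.Adj a b) (hH : ¬ H.Adj a b) :
    Nat.card H.edgeSet < Nat.card G.edgeSet :=
  Set.ncard_lt_ncard ⟨SimpleGraph.edgeSet_mono h, fun h' => hH (h' (a := s(a, b)) hG)⟩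
    (Set.toFinite _)

theorem cyclomaticNumber_deleteEdges_of_core {a b : V} (h : (core G).Adj a b) :
    cyclomaticNumber (G.deleteEdges {s(a, b)}) = cyclomaticNumber G - 1 := by
  obtain ⟨hab, hr⟩ := core_adj_iff.1 h
  have h1 := card_edgeSet_deleteEdges hab
  rw [cyclomaticNumber, cyclomaticNumber, card_connectedComponent_of_reachable hr, ← h1]
  push_cast
  ring

theorem cyclomaticNumber_deleteEdges_of_not_core {a b : V} (hab : G.Adj a b)
    (h : ¬ (core G).Adj a b) :
    cyclomaticNumber (G.deleteEdges {s(a, b)}) = cyclomaticNumber G := by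
  have h1 := card_edgeSet_deleteEdges hab
  rw [cyclomaticNumber, cyclomaticNumber, card_connectedComponent_of_not_reachable hab
    fun hr => h (core_adj_iff.2 ⟨hab, hr⟩), ← h1]
  push_cast
  ring

theorem cyclomaticNumber_mono (h : H ≤ G) : cyclomaticNumber H ≤ cyclomaticNumber G := by
  induction hk : Nat.card G.edgeSet using Nat.strong_induction_on generalizing G with
  | _ k ih =>
    by_cases hne : H = G
    · rw [hne]
    · obtain ⟨a, b, hab, hH⟩ := exists_adj_of_le_of_ne h hne
      have hc := card_edgeSet_deleteEdges hab
      have := ih _ (by omega) (le_deleteEdges h hH) rfl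
      refine this.trans ?_
      by_cases hcore : (core G).Adj a b
      · rw [cyclomaticNumber_deleteEdges_of_core hcore]
        omega
      · rw [cyclomaticNumber_deleteEdges_of_not_core hab hcore]

/-- Deleting bridges does not change the cyclomatic number. -/
theorem cyclomaticNumber_eq_of_not_core (h : H ≤ G)
    (hcore : ∀ a b, (core G).Adj a b → H.Adj a b) :
    cyclomaticNumber H = cyclomaticNumber G := by
  induction hk : Nat.card G.edgeSet using Nat.strong_induction_on generalizing G with
  | _ k ih =>
    by_cases hne : H = G
    · rw [hne]
    · obtain ⟨a, b, hab, hH⟩ := exists_adj_of_le_of_ne h hne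
      have hc := card_edgeSet_deleteEdges hab
      have := ih _ (by omega) (le_deleteEdges h hH) (fun x y hxy =>
        hcore x y (core_mono (SimpleGraph.deleteEdges_le _) hxy)) rfl
      rw [this, cyclomaticNumber_deleteEdges_of_not_core hab fun h' => hH (hcore _ _ h')]

theorem cyclomaticNumber_deleteIncidenceSet_lt {x : V} (h : x ∈ (core G).support) :
    cyclomaticNumber (G.deleteIncidenceSet x) + 1 ≤ cyclomaticNumber G := by
  obtain ⟨y, hy⟩ := h
  have := cyclomaticNumber_mono (deleteIncidenceSet_le_deleteEdges G x y)
  rw [cyclomaticNumber_deleteEdges_of_core hy] at this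
  omega

theorem cyclomaticNumber_deleteIncidenceSet_of_notMem {x : V} (h : x ∉ (core G).support) :
    cyclomaticNumber (G.deleteIncidenceSet x) = cyclomaticNumber G :=
  cyclomaticNumber_eq_of_not_core (G.deleteIncidenceSet_le x) fun _ _ =>
    core_adj_deleteIncidenceSet_of_notMem h

theorem cyclomaticNumber_sdiff_lt (hC : IsCyc C n) (h : C ≤ G) :
    cyclomaticNumber (G \ C) + 1 ≤ cyclomaticNumber G := by
  obtain ⟨g, hg⟩ := id hC
  have h0 := hg.adj_succ 0
  have hle : G \ C ≤ G.deleteEdges {s(g 0, g (0 + 1))} :=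
    le_deleteEdges sdiff_le fun h' => h'.2 h0
  have := cyclomaticNumber_mono hle
  rw [cyclomaticNumber_deleteEdges_of_core ⟨C, n, hC, h, h0⟩] at this
  omega

/-- Once one edge of the cycle `C` is deleted, its other edges are bridges if no other cycle of `G`
meets `C`. -/
theorem cyclomaticNumber_le_sdiff_add_one (hC : IsCyc C n) (h : C ≤ G)
    (hdisj : ∀ D m, IsCyc D m → D ≤ G → C ≠ D → Disjoint C.support D.support) :
    cyclomaticNumber G ≤ cyclomaticNumber (G \ C) + 1 := by
  obtain ⟨g, hg⟩ := id hC
  have h0 := hg.adj_succ 0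
  have hle : G \ C ≤ G.deleteEdges {s(g 0, g (0 + 1))} :=
    le_deleteEdges sdiff_le fun h' => h'.2 h0
  have key := cyclomaticNumber_eq_of_not_core hle (by
    rintro a b ⟨D, m, hD, hDG, hab⟩
    refine ⟨SimpleGraph.deleteEdges_le _ (hDG hab), fun hCab => ?_⟩
    by_cases hCD : C = D
    · subst hCD
      have := hDG h0
      rw [SimpleGraph.deleteEdges_adj] at this
      exact this.2 rfl
    · exact Set.disjoint_left.1
        (hdisj D m hD (hDG.trans (SimpleGraph.deleteEdges_le _)) hCD) ⟨b, hCab⟩ ⟨b, hab⟩)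
  rw [key, cyclomaticNumber_deleteEdges_of_core ⟨C, n, hC, h, h0⟩]
  omega

end Cyclomatic

/-! ### The quadratic form of a cycle -/

section CycleForm

open Module

variable {V : Type*} [Fintype V] {C G : SimpleGraph V} {n : ℕ} {g : ℕ → V}

theorem succ_mod_of_lt {i n : ℕ} (hi : i < n) : (i + 1) % n = if i + 1 = n then 0 else i + 1 := by
  split_ifs with h
  · rw [h, Nat.mod_self]
  · exact Nat.mod_eq_of_lt (by omega)

theorem CycEnum.adjForm_eq (h : CycEnum C n g) (x : V → ℝ) :
    adjForm C x = 2 * ∑ i ∈ Finset.range n, x (g i) * x (g (i + 1)) := by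
  classical
  have h3 := h.1
  have hmod : ∀ i j, g i = g j → i % n = j % n := fun i j hij => (h.2.1 i j).1 hij
  have hlt : ∀ i j, i < n → j < n → g i = g j → i = j := fun i j hi hj => h.inj_lt hi hj
  have hpairs : (Finset.univ.filter fun p : V × V => C.Adj p.1 p.2) =
      (Finset.range n).image (fun i => (g i, g (i + 1))) ∪
        (Finset.range n).image (fun i => (g (i + 1), g i)) := by
    ext ⟨a, b⟩
    simp only [Finset.mem_filter, Finset.mem_univ, true_and, Finset.mem_union, Finset.mem_image,
      Finset.mem_range, Prod.mk.injEq]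
    rw [h.2.2]
    constructor
    · rintro ⟨i, hi⟩
      have e1 := h.apply_mod i
      have e2 : g (i % n + 1) = g (i + 1) := (h.2.1 _ _).2 ((Nat.mod_modEq i n).add_right 1)
      have hin : i % n < n := Nat.mod_lt _ (by omega)
      rcases Sym2.eq_iff.1 hi with ⟨rfl, rfl⟩ | ⟨rfl, rfl⟩
      · exact Or.inl ⟨i % n, hin, e1, e2⟩
      · exact Or.inr ⟨i % n, hin, e2, e1⟩
    · rintro (⟨i, -, rfl, rfl⟩ | ⟨i, -, rfl, rfl⟩)
      · exact ⟨i, rfl⟩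
      · exact ⟨i, Sym2.eq_swap⟩
  have hdisj : Disjoint ((Finset.range n).image (fun i => (g i, g (i + 1))))
      ((Finset.range n).image (fun i => (g (i + 1), g i))) := by
    rw [Finset.disjoint_left]
    rintro ⟨a, b⟩ h1 h2
    simp only [Finset.mem_image, Finset.mem_range, Prod.mk.injEq] at h1 h2
    obtain ⟨i, hi, rfl, rfl⟩ := h1
    obtain ⟨j, hj, h4, h5⟩ := h2
    -- the indices satisfy `j + 1 ≡ i` and `j ≡ i + 1` modulo `n`, but `n ≥ 3`
    have e1 := hmod _ _ h4
    have e2 := hmod _ _ h5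
    rw [succ_mod_of_lt hj, Nat.mod_eq_of_lt hi] at e1
    rw [succ_mod_of_lt hi, Nat.mod_eq_of_lt hj] at e2
    split_ifs at e1 e2 <;> omega
  have e0 : adjForm C x = ∑ p : V × V, if C.Adj p.1 p.2 then x p.1 * x p.2 else 0 := by
    rw [adjForm_apply, ← Finset.univ_product_univ, Finset.sum_product]
    refine Finset.sum_congr rfl fun a _ => Finset.sum_congr rfl fun b _ => ?_
    by_cases hab : C.Adj a b
    · simp [adjInd_of_adj hab, hab]
    · simp [adjInd_of_not_adj hab, hab]
  rw [e0, ← Finset.sum_filter, hpairs, Finset.sum_union hdisj, Finset.sum_image, Finset.sum_image,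
    two_mul]
  · congr 1
    exact Finset.sum_congr rfl fun i _ => mul_comm _ _
  · intro i hi j hj hij
    exact hlt i j (by simpa using hi) (by simpa using hj) (Prod.mk.inj hij).2
  · intro i hi j hj hij
    exact hlt i j (by simpa using hi) (by simpa using hj) (Prod.mk.inj hij).1

theorem sum_path_eq (y : ℕ → ℝ) (k : ℕ) :
    ∑ i ∈ Finset.range (2 * k), y i * y (i + 1) =
      ∑ j ∈ Finset.range k, y (2 * j + 1) * (y (2 * j) + y (2 * j + 2)) := by
  induction k with
  | zero => simp
  | succ k ih =>
    rw [show 2 * (k + 1) = 2 * k + 1 + 1 by ring, Finset.sum_range_succ, Finset.sum_range_succ, ih,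
      Finset.sum_range_succ]
    ring

theorem even_terms_of_add_eq_zero (y : ℕ → ℝ) (k : ℕ)
    (h : ∀ j < k, y (2 * j) + y (2 * j + 2) = 0) : ∀ j ≤ k, y (2 * j) = (-1) ^ j * y 0 := by
  intro j
  induction j with
  | zero => simp
  | succ j ih =>
    intro hj
    have h1 := ih (by omega)
    have h2 := h j (by omega)
    rw [show 2 * (j + 1) = 2 * j + 2 by ring, pow_succ]
    linarith

theorem alternating_telescope (y : ℕ → ℝ) (k : ℕ) :
    ∑ j ∈ Finset.range k, (-1) ^ j * (y (2 * j) + y (2 * j + 2)) = y 0 - (-1) ^ k * y (2 * k) := by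
  induction k with
  | zero => simp
  | succ k ih =>
    rw [Finset.sum_range_succ, ih, show 2 * (k + 1) = 2 * k + 2 by ring, pow_succ]
    ring

/-- The form of a cycle is nonpositive on a subspace of codimension `n / 2` unless `n ≡ 1 mod 4`.
For even `n` every second coordinate is set to zero. For `n = 2 k + 1` the conditions
`x_{2j} + x_{2j+2} = 0`, `j < k`, leave `2 (-1) ^ k x_0 ^ 2`. -/
theorem IsCyc.exists_nonpos (h : IsCyc C n) (hn : n % 4 ≠ 1) :
    ∃ L : (V → ℝ) →ₗ[ℝ] (Fin (n / 2) → ℝ), ∀ x, L x = 0 → adjForm C x ≤ 0 := by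
  obtain ⟨g, hg⟩ := h
  rcases Nat.even_or_odd' n with ⟨k, rfl | rfl⟩
  · refine ⟨LinearMap.pi fun j => LinearMap.proj (g (2 * j + 1)), fun x hx => ?_⟩
    have hx' : ∀ j < k, x (g (2 * j + 1)) = 0 := fun j hj => congrFun hx ⟨j, by omega⟩
    rw [hg.adjForm_eq, sum_path_eq (fun i => x (g i)), Finset.sum_eq_zero]
    · simp
    · intro j hj
      rw [hx' j (Finset.mem_range.1 hj), zero_mul]
  · let π : V → (V → ℝ) →ₗ[ℝ] ℝ := LinearMap.proj
    refine ⟨LinearMap.pi fun j => π (g (2 * j)) + π (g (2 * j + 2)), fun x hx => ?_⟩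
    have hx' : ∀ j < k, x (g (2 * j)) + x (g (2 * j + 2)) = 0 :=
      fun j hj => congrFun hx ⟨j, by omega⟩
    have hlast := even_terms_of_add_eq_zero (fun i => x (g i)) k hx' k le_rfl
    have hodd : Odd k := by
      rw [Nat.odd_iff]
      omega
    have hper : g (2 * k + 1) = g 0 := (hg.2.1 _ _).2 (by simp [Nat.ModEq])
    simp only [hodd.neg_one_pow] at hlast
    rw [hg.adjForm_eq, Finset.sum_range_succ, sum_path_eq (fun i => x (g i)), Finset.sum_eq_zero]
    · rw [hper, hlast]
      nlinarith [sq_nonneg (x (g 0))]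
    · intro j hj
      rw [hx' j (Finset.mem_range.1 hj), mul_zero]

/-- For `n = 2 k + 1` with `k` even, the `k` conditions
`x_{2j+1} = x_{2j} + x_{2j+2} + (-1) ^ j x_0` turn half the form of the cycle into the sum of
squares `x_0 ^ 2 + ∑ (x_{2j} + x_{2j+2}) ^ 2`. -/
theorem CycEnum.adjForm_pos (hg : CycEnum C n g) {k : ℕ} (hn : n = 2 * k + 1) (hk : Even k)
    {x : V → ℝ}
    (hx : ∀ j < k, x (g (2 * j + 1)) = x (g (2 * j)) + x (g (2 * j + 2)) + (-1) ^ j * x (g 0))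
    (hne : ∃ i < n, x (g i) ≠ 0) : 0 < adjForm C x := by
  subst hn
  have hper : g (2 * k + 1) = g 0 := (hg.2.1 _ _).2 (by simp [Nat.ModEq])
  have htel := alternating_telescope (fun i => x (g i)) k
  simp only [hk.neg_one_pow, one_mul] at htel
  have hform : adjForm C x = 2 * (∑ j ∈ Finset.range k, (x (g (2 * j)) + x (g (2 * j + 2))) ^ 2 +
      x (g 0) ^ 2) := by
    rw [hg.adjForm_eq, Finset.sum_range_succ, sum_path_eq (fun i => x (g i)), hper]
    have : ∀ j ∈ Finset.range k, x (g (2 * j + 1)) * (x (g (2 * j)) + x (g (2 * j + 2))) =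
        (x (g (2 * j)) + x (g (2 * j + 2))) ^ 2 +
          x (g 0) * ((-1) ^ j * (x (g (2 * j)) + x (g (2 * j + 2)))) := by
      intro j hj
      rw [hx j (Finset.mem_range.1 hj)]
      ring
    rw [Finset.sum_congr rfl this, Finset.sum_add_distrib, ← Finset.mul_sum, htel]
    ring
  have hs : 0 ≤ ∑ j ∈ Finset.range k, (x (g (2 * j)) + x (g (2 * j + 2))) ^ 2 :=
    Finset.sum_nonneg fun j _ => sq_nonneg _
  rw [hform]
  by_contra hle
  have h0 : x (g 0) = 0 := by
    have : x (g 0) ^ 2 = 0 := le_antisymm (by linarith) (sq_nonneg _)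
    simpa using this
  have hsum : ∑ j ∈ Finset.range k, (x (g (2 * j)) + x (g (2 * j + 2))) ^ 2 = 0 :=
    le_antisymm (by nlinarith [sq_nonneg (x (g 0))]) hs
  have hz : ∀ j < k, x (g (2 * j)) + x (g (2 * j + 2)) = 0 := by
    intro j hj
    have := (Finset.sum_eq_zero_iff_of_nonneg fun j _ => sq_nonneg _).1 hsum j
      (Finset.mem_range.2 hj)
    simpa using this
  have heven := even_terms_of_add_eq_zero (fun i => x (g i)) k hz
  obtain ⟨i, hi, hne⟩ := hne
  rcases Nat.even_or_odd' i with ⟨j, rfl | rfl⟩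
  · refine hne ((heven j (by omega)).trans ?_)
    simp [h0]
  · exact hne (by rw [hx j (by omega), hz j (by omega), h0]; simp)

/-- A component of `G` that is a cycle of length `n ≡ 1 mod 4` contributes `n / 2 + 1`. -/
theorem IsCyc.inertia_sdiff_add_le (h : IsCyc C n) (hn : n % 4 = 1) (hC : C ≤ G)
    (hdisj : Disjoint (G \ C).support C.support) :
    inertia (G \ C) + (n / 2 + 1) ≤ inertia G := by
  obtain ⟨g, hg⟩ := h
  obtain ⟨k, hk⟩ : ∃ k, n = 2 * k + 1 := ⟨n / 2, by omega⟩
  have hke : Even k := by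
    rw [Nat.even_iff]
    omega
  have hinj : Function.Injective fun i : Fin n => g i := fun i j hij =>
    Fin.ext (hg.inj_lt i.2 j.2 hij)
  let E : (Fin n → ℝ) →ₗ[ℝ] (V → ℝ) := Function.ExtendByZero.linearMap ℝ fun i : Fin n => g i
  have hE : ∀ t (i : Fin n), E t (g i) = t i := fun t i => hinj.extend_apply t 0 i
  let π : V → (V → ℝ) →ₗ[ℝ] ℝ := LinearMap.proj
  let L : (V → ℝ) →ₗ[ℝ] (Fin k → ℝ) := LinearMap.pi fun j =>
    π (g (2 * j + 1)) - π (g (2 * j)) - π (g (2 * j + 2)) - ((-1 : ℝ) ^ (j : ℕ)) • π (g 0)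
  let F := LinearMap.ker (L ∘ₗ E)
  have hF : n / 2 + 1 ≤ finrank ℝ F := by
    have h1 := (L ∘ₗ E).finrank_range_add_finrank_ker
    have h2 : finrank ℝ (LinearMap.range (L ∘ₗ E)) ≤ finrank ℝ (Fin k → ℝ) :=
      Submodule.finrank_le _
    rw [finrank_fin_fun] at h1 h2
    change _ + finrank ℝ F = n at h1
    omega
  refine le_trans (Nat.add_le_add_left hF _)
    (GraphInertia.inertia_sdiff_add_le hC hdisj (E ∘ₗ F.subtype) ?_)
  rintro ⟨t, ht⟩ h0
  refine hg.adjForm_pos hk hke (fun j hj => ?_) ?_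
  · have h1 : E t (g (2 * j + 1)) - E t (g (2 * j)) - E t (g (2 * j + 2)) -
        (-1 : ℝ) ^ j * E t (g 0) = 0 := congrFun (LinearMap.mem_ker.1 ht) ⟨j, hj⟩
    change E t (g (2 * j + 1)) = E t (g (2 * j)) + E t (g (2 * j + 2)) + (-1) ^ j * E t (g 0)
    linarith
  · by_contra! hall
    refine h0 (Subtype.ext (funext fun i => ?_))
    exact (hE t i).symm.trans (hall i i.2)

/-- A cycle whose length is not `1` modulo `4` contributes at most `n / 2`. -/
theorem IsCyc.inertia_le_sdiff_add (h : IsCyc C n) (hn : n % 4 ≠ 1) (hC : C ≤ G) :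
    inertia G ≤ inertia (G \ C) + n / 2 := by
  obtain ⟨L, hL⟩ := h.exists_nonpos hn
  have := inertia_le_add (G := G) (G' := G \ C) L fun x hx => by
    rw [adjForm_sdiff hC]
    linarith [hL x hx]
  rwa [finrank_fin_fun] at this

end CycleForm

/-! ### Pendant vertices and leaf cycles -/

section Leaves

variable {V : Type*} {G : SimpleGraph V}

/-- Distinct cycles of `G` have no common vertex. -/
def DisjointCycles (G : SimpleGraph V) : Prop :=
  ∀ C D n m, IsCyc C n → IsCyc D m → C ≤ G → D ≤ G → C ≠ D → Disjoint C.support D.support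

/-- A component of `G` without the edge `e` that misses the vertex `v` stays connected when an edge
at `v` is deleted instead of `e`. -/
theorem reachable_deleteEdges_of_avoid {e : Sym2 V} {v w z t : V}
    (havoid : ∀ t, (G.deleteEdges {e}).Reachable z t → t ≠ v)
    (h : (G.deleteEdges {e}).Reachable z t) : (G.deleteEdges {s(v, w)}).Reachable z t := by
  have h' := h
  rw [SimpleGraph.reachable_iff_reflTransGen] at h
  induction h with
  | refl => exact SimpleGraph.Reachable.refl _
  | @tail b c hb hbc ih =>
    have hb' : (G.deleteEdges {e}).Reachable z b := by
      rwa [SimpleGraph.reachable_iff_reflTransGen]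
    refine (ih hb').trans (SimpleGraph.Adj.reachable ?_)
    rw [SimpleGraph.deleteEdges_adj] at hbc ⊢
    refine ⟨hbc.1, fun he => ?_⟩
    rcases Sym2.eq_iff.1 (Set.mem_singleton_iff.1 he) with ⟨rfl, -⟩ | ⟨-, rfl⟩
    · exact havoid _ hb' rfl
    · exact havoid _ h' rfl

variable [Finite V]

/-- If `G` has a bridge, then some bridge `xy` has no further bridge on the side of `x`. -/
theorem exists_extremal_bridge (h : ∃ a b, G.Adj a b ∧ ¬ (core G).Adj a b) :
    ∃ x y, G.Adj x y ∧ ¬ (core G).Adj x y ∧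
      ∀ z w, (G.deleteEdges {s(x, y)}).Reachable x z → G.Adj z w → s(z, w) ≠ s(x, y) →
        (core G).Adj z w := by
  obtain ⟨a, b, hab, hc⟩ := h
  induction hk : {t | (G.deleteEdges {s(a, b)}).Reachable a t}.ncard using
    Nat.strong_induction_on generalizing a b with
  | _ k ih =>
    by_cases hall : ∀ z w, (G.deleteEdges {s(a, b)}).Reachable a z → G.Adj z w →
        s(z, w) ≠ s(a, b) → (core G).Adj z w
    · exact ⟨a, b, hab, hc, hall⟩
    push Not at hall
    obtain ⟨z, w, hz, hzw, hne, hcore⟩ := hall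
    have hw : (G.deleteEdges {s(a, b)}).Reachable a w := by
      refine hz.trans (SimpleGraph.Adj.reachable ?_)
      rw [SimpleGraph.deleteEdges_adj]
      exact ⟨hzw, hne⟩
    have hbridge : ¬ (G.deleteEdges {s(z, w)}).Reachable z w := fun hr =>
      hcore (core_adj_iff.2 ⟨hzw, hr⟩)
    -- one of the two sides of `zw` misses `a`; it is then a proper part of the side of `a`
    have key : ∀ z w, (G.deleteEdges {s(a, b)}).Reachable a z → G.Adj z w →
        ¬ (core G).Adj z w → ¬ (G.deleteEdges {s(z, w)}).Reachable z a →
        {t | (G.deleteEdges {s(z, w)}).Reachable z t}.ncard < k := by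
      intro z w hz _ _ hza
      rw [← hk]
      refine Set.ncard_lt_ncard ⟨fun t ht => ?_, fun hsub => hza (hsub ?_)⟩ (Set.toFinite _)
      · refine hz.trans (reachable_deleteEdges_of_avoid (e := s(z, w)) ?_ ht)
        rintro t ht rfl
        exact hza ht
      · exact SimpleGraph.Reachable.refl _
    by_cases hza : (G.deleteEdges {s(z, w)}).Reachable z a
    · have hwa : ¬ (G.deleteEdges {s(w, z)}).Reachable w a := by
        rw [Sym2.eq_swap]
        exact fun hwa => hbridge (hza.trans hwa.symm)
      have hcore' : ¬ (core G).Adj w z := fun h' => hcore h'.symm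
      exact ih _ (key w z hw hzw.symm hcore' hwa) w z hzw.symm hcore' rfl
    · exact ih _ (key z w hz hzw hcore hza) z w hzw hcore rfl

/-- A graph with disjoint cycles that has a bridge has a pendant vertex, or a cycle which a single
edge joins to the rest of the graph. -/
theorem exists_pendant_or_leaf_cycle (hdisj : DisjointCycles G)
    (h : ∃ a b, G.Adj a b ∧ ¬ (core G).Adj a b) :
    ∃ x y, G.Adj x y ∧ ¬ (core G).Adj x y ∧
      ((∀ z, G.Adj x z → z = y) ∨
        ∃ C n, IsCyc C n ∧ C ≤ G ∧ x ∈ C.support ∧ y ∉ C.support ∧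
          ∀ a b, a ∈ C.support → G.Adj a b → C.Adj a b ∨ (a = x ∧ b = y)) := by
  obtain ⟨x, y, hxy, hcore, hside⟩ := exists_extremal_bridge h
  refine ⟨x, y, hxy, hcore, ?_⟩
  by_cases hp : ∀ z, G.Adj x z → z = y
  · exact Or.inl hp
  right
  push Not at hp
  obtain ⟨z, hxz, hzy⟩ := hp
  have hbridge : ¬ (G.deleteEdges {s(x, y)}).Reachable x y := fun hr =>
    hcore (core_adj_iff.2 ⟨hxy, hr⟩)
  obtain ⟨C, n, hC, hCG, hCxz⟩ := hside x z (SimpleGraph.Reachable.refl _) hxz (by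
    rw [Ne, Sym2.congr_right]
    exact hzy)
  have hxC : x ∈ C.support := ⟨z, hCxz⟩
  have hnot : ¬ C.Adj x y := fun h' => hcore ⟨C, n, hC, hCG, h'⟩
  have hreach : ∀ a ∈ C.support, (G.deleteEdges {s(x, y)}).Reachable x a := fun a ha =>
    (hC.reachable hxC ha).mono (le_deleteEdges hCG hnot)
  refine ⟨C, n, hC, hCG, hxC, fun hy => hbridge (hreach y hy), fun a b ha hab => ?_⟩
  by_cases he : s(a, b) = s(x, y)
  · rcases Sym2.eq_iff.1 he with h' | ⟨rfl, rfl⟩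
    · exact Or.inr h'
    · exact (hbridge (hreach _ ha)).elim
  · left
    obtain ⟨D, m, hD, hDG, hDab⟩ := hside a b (hreach a ha) hab he
    by_cases hCD : C = D
    · rw [hCD]
      exact hDab
    · exact (Set.disjoint_left.1 (hdisj C D n m hC hD hCG hDG hCD) ha ⟨b, hDab⟩).elim

theorem exists_pendant_of_core_eq_bot (hG : core G = ⊥) (hne : ∃ a b, G.Adj a b) :
    ∃ x y, G.Adj x y ∧ ∀ z, G.Adj x z → z = y := by
  obtain ⟨a, b, hab⟩ := hne
  have hno : ∀ C n, IsCyc C n → ¬ C ≤ G := by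
    intro C n hC hCG
    obtain ⟨g, hg⟩ := id hC
    have h0 : (core G).Adj (g 0) (g (0 + 1)) := ⟨C, n, hC, hCG, hg.adj_succ 0⟩
    rw [hG] at h0
    exact h0
  obtain ⟨x, y, hxy, -, h | ⟨C, n, hC, hCG, -⟩⟩ := exists_pendant_or_leaf_cycle
    (fun C D n m hC _ hCG => (hno C n hC hCG).elim) ⟨a, b, hab, by simp [hG]⟩
  · exact ⟨x, y, hxy, h⟩
  · exact (hno C n hC hCG).elim

end Leaves

/-! ### The upper bound -/

section UpperBound

variable {V : Type*} {G : SimpleGraph V}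

theorem matchingNumber_pendant [Finite V] {x y : V} (hxy : G.Adj x y)
    (hp : ∀ z, G.Adj x z → z = y) :
    matchingNumber (G.deleteIncidenceSet y) + 1 ≤ matchingNumber G := by
  refine matchingNumber_add_one_le (G.deleteIncidenceSet_le y) hxy ?_ ?_
  · rintro ⟨z, hz⟩
    replace hz := SimpleGraph.deleteIncidenceSet_adj.1 hz
    exact hz.2.2 (hp z hz.1)
  · rintro ⟨z, hz⟩
    replace hz := SimpleGraph.deleteIncidenceSet_adj.1 hz
    exact hz.2.1 rfl

theorem card_edgeSet_deleteIncidenceSet_lt [Finite V] {x y : V} (hxy : G.Adj x y) :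
    Nat.card (G.deleteIncidenceSet y).edgeSet < Nat.card G.edgeSet :=
  card_edgeSet_lt (G.deleteIncidenceSet_le y) hxy fun h =>
    (SimpleGraph.deleteIncidenceSet_adj.1 h).2.2 rfl

/-- The upper bound `p ≤ m + c`, by isolating the neighbour of a pendant vertex in a forest and a
vertex of a cycle otherwise. -/
theorem inertia_le_matchingNumber_add [Fintype V] (G : SimpleGraph V) :
    (inertia G : ℤ) ≤ matchingNumber G + cyclomaticNumber G := by
  induction hk : Nat.card G.edgeSet using Nat.strong_induction_on generalizing G with
  | _ k ih =>
    by_cases hcore : core G = ⊥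
    · by_cases hne : ∃ a b, G.Adj a b
      · obtain ⟨x, y, hxy, hp⟩ := exists_pendant_of_core_eq_bot hcore hne
        have h1 := ih _ (hk ▸ card_edgeSet_deleteIncidenceSet_lt hxy) _ rfl
        have h2 := inertia_le_deleteIncidenceSet G y
        have h3 := matchingNumber_pendant hxy hp
        have h4 := cyclomaticNumber_mono (G.deleteIncidenceSet_le y)
        omega
      · have hbot : G = ⊥ := by
          ext a b
          simpa using fun hab => hne ⟨a, b, hab⟩
        rw [hbot, inertia_bot, cyclomaticNumber_bot]
        omega
    · obtain ⟨a, b, hab⟩ : ∃ a b, (core G).Adj a b := by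
        by_contra! hc
        exact hcore (by ext a b; simpa using hc a b)
      have h1 := ih _ (hk ▸ card_edgeSet_deleteIncidenceSet_lt (core_le G hab)) _ rfl
      have h2 := inertia_le_deleteIncidenceSet G b
      have h3 := matchingNumber_mono (G.deleteIncidenceSet_le b)
      have h4 := cyclomaticNumber_deleteIncidenceSet_lt (G := G) (x := b) ⟨a, hab.symm⟩
      omega

end UpperBound

/-! ### Bridge covers -/

section Certificates

variable {V : Type*} {C D G H : SimpleGraph V} {n m : ℕ}

/-- The subgraph of `G` induced by the vertices that lie on no cycle, as a graph on all of `V`. -/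
def acyclicPart (G : SimpleGraph V) : SimpleGraph V where
  Adj a b := G.Adj a b ∧ a ∉ (core G).support ∧ b ∉ (core G).support
  symm := ⟨fun _ _ ⟨h, ha, hb⟩ => ⟨h.symm, hb, ha⟩⟩
  loopless := ⟨fun _ h => h.1.ne rfl⟩

theorem acyclicPart_le (G : SimpleGraph V) : acyclicPart G ≤ G := fun _ _ h => h.1

/-- The form that the condition on matchings of the contraction takes in `G` itself: a vertex cover
`U` of the bridges that avoids all cycles and is no larger than a matching that avoids all
cycles. -/
def BridgeCover (G : SimpleGraph V) (U : Finset V) : Prop :=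
  (∀ u ∈ U, u ∉ (core G).support) ∧
  (∀ a b, G.Adj a b → ¬ (core G).Adj a b → a ∈ U ∨ b ∈ U) ∧
  U.card ≤ matchingNumber (acyclicPart G)

/-- The structural side of the equivalence, in terms of subgraphs of `G`. -/
def CycleCriterion (G : SimpleGraph V) : Prop :=
  DisjointCycles G ∧ (∀ C n, IsCyc C n → C ≤ G → n % 4 = 1) ∧ ∃ U, BridgeCover G U

theorem DisjointCycles.mono (hG : DisjointCycles G) (h : H ≤ G) : DisjointCycles H :=
  fun C D n m hC hD hCH hDH => hG C D n m hC hD (hCH.trans h) (hDH.trans h)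

theorem core_deleteIncidenceSet {y : V} (hy : y ∉ (core G).support) :
    core (G.deleteIncidenceSet y) = core G := by
  refine le_antisymm (core_mono (G.deleteIncidenceSet_le y)) ?_
  rintro a b ⟨C, n, hC, hCG, hab⟩
  exact ⟨C, n, hC, fun c d hcd =>
    core_adj_deleteIncidenceSet_of_notMem hy (hC.le_core hCG hcd), hab⟩

theorem IsCyc.le_deleteIncidenceSet (hCG : C ≤ G) {y : V} (hy : y ∉ C.support) :
    C ≤ G.deleteIncidenceSet y := by
  intro a b hab
  rw [SimpleGraph.deleteIncidenceSet_adj]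
  refine ⟨hCG hab, ?_, ?_⟩
  · rintro rfl
    exact hy ⟨b, hab⟩
  · rintro rfl
    exact hy ⟨a, hab.symm⟩

theorem notMem_support_deleteIncidenceSet (G : SimpleGraph V) (x : V) :
    x ∉ (G.deleteIncidenceSet x).support := by
  rintro ⟨z, hz⟩
  exact (SimpleGraph.deleteIncidenceSet_adj.1 hz).2.1 rfl

/-- The other cycles survive the deletion of a vertex of `C`. -/
theorem DisjointCycles.mem_core_deleteIncidenceSet (hdisj : DisjointCycles G) (hC : IsCyc C n)
    (hCG : C ≤ G) {x v : V} (hx : x ∈ C.support) (hv : v ∉ C.support)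
    (hvG : v ∈ (core G).support) : v ∈ (core (G.deleteIncidenceSet x)).support := by
  obtain ⟨D, m, hD, hDG, hvD⟩ := mem_support_core.1 hvG
  have hCD : C ≠ D := by
    rintro rfl
    exact hv hvD
  refine mem_support_core.2 ⟨D, m, hD, IsCyc.le_deleteIncidenceSet hDG ?_, hvD⟩
  exact Set.disjoint_left.1 (hdisj C D n m hC hD hCG hDG hCD) hx

theorem DisjointCycles.core_deleteIncidenceSet_disjoint (hdisj : DisjointCycles G)
    (hC : IsCyc C n) (hCG : C ≤ G) {x : V} (hx : x ∈ C.support) :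
    Disjoint (core (G.deleteIncidenceSet x)).support C.support := by
  rw [Set.disjoint_left]
  intro v hv hvC
  obtain ⟨D, m, hD, hDG, hvD⟩ := mem_support_core.1 hv
  have hCD : C ≠ D := by
    rintro rfl
    exact notMem_support_deleteIncidenceSet G x (SimpleGraph.support_mono hDG hx)
  exact Set.disjoint_left.1
    (hdisj C D n m hC hD hCG (hDG.trans (G.deleteIncidenceSet_le x)) hCD) hvC hvD

/-- In a graph without bridges and with disjoint cycles, each cycle is a component. -/
theorem DisjointCycles.sdiff_disjoint (hdisj : DisjointCycles G) (hC : IsCyc C n) (hCG : C ≤ G)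
    (hcore : ∀ a b, G.Adj a b → (core G).Adj a b) : Disjoint (G \ C).support C.support := by
  rw [Set.disjoint_left]
  rintro a ⟨b, hab, hCab⟩ haC
  obtain ⟨D, m, hD, hDG, hDab⟩ := hcore a b hab
  have hCD : C ≠ D := by
    rintro rfl
    exact hCab hDab
  exact Set.disjoint_left.1 (hdisj C D n m hC hD hCG hDG hCD) haC ⟨b, hDab⟩

/-- A cover of the bridges of `G - y` extends to one of `G` by adding `y`. -/
theorem BridgeCover.insert [DecidableEq V] {U : Finset V} {y : V} (hy : y ∉ (core G).support)
    (h : BridgeCover (G.deleteIncidenceSet y) U)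
    (hm : matchingNumber (acyclicPart (G.deleteIncidenceSet y)) + 1 ≤
      matchingNumber (acyclicPart G)) : BridgeCover G (insert y U) := by
  obtain ⟨h1, h2, h3⟩ := h
  rw [core_deleteIncidenceSet hy] at h1 h2
  refine ⟨fun u hu => ?_, fun a b hab hc => ?_, ?_⟩
  · rcases Finset.mem_insert.1 hu with rfl | hu
    · exact hy
    · exact h1 u hu
  · by_cases ha : a = y
    · exact Or.inl (ha ▸ Finset.mem_insert_self _ _)
    by_cases hb : b = y
    · exact Or.inr (hb ▸ Finset.mem_insert_self _ _)
    exact (h2 a b (SimpleGraph.deleteIncidenceSet_adj.2 ⟨hab, ha, hb⟩) hc).imp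
      (Finset.mem_insert_of_mem) (Finset.mem_insert_of_mem)
  · have := Finset.card_insert_le y U
    omega

variable [Finite V]

theorem IsCyc.two_mul_matchingNumber_le (hC : IsCyc C n) : 2 * matchingNumber C ≤ n := by
  classical
  obtain ⟨g, hg⟩ := hC
  refine (GraphInertia.two_mul_matchingNumber_le (S := (Finset.range n).image g)
    fun a b hab => ?_).trans_eq hg.card_image
  have : a ∈ C.support := ⟨b, hab⟩
  rw [hg.support_eq] at this
  exact this

theorem IsCyc.two_mul_matchingNumber_deleteIncidenceSet_le (hC : IsCyc C n) {x : V}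
    (hx : x ∈ C.support) : 2 * matchingNumber (C.deleteIncidenceSet x) ≤ n - 1 := by
  classical
  obtain ⟨g, hg⟩ := hC
  rw [hg.support_eq] at hx
  refine (GraphInertia.two_mul_matchingNumber_le (S := ((Finset.range n).image g).erase x)
    fun a b hab => ?_).trans_eq ?_
  · rw [SimpleGraph.deleteIncidenceSet_adj] at hab
    have : a ∈ C.support := ⟨b, hab.1⟩
    rw [hg.support_eq] at this
    exact Finset.mem_erase.2 ⟨hab.2.1, this⟩
  · rw [Finset.card_erase_of_mem hx, hg.card_image]

theorem matchingNumber_acyclicPart_add_core_le (G : SimpleGraph V) :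
    matchingNumber (acyclicPart G) + matchingNumber (core G) ≤ matchingNumber G := by
  refine matchingNumber_add_le (acyclicPart_le G) (core_le G) ?_
  rw [Set.disjoint_left]
  rintro a ⟨b, hab⟩
  exact hab.2.1

theorem BridgeCover.matchingNumber_le {U : Finset V} (h : BridgeCover G U) :
    matchingNumber G ≤ matchingNumber (acyclicPart G) + matchingNumber (core G) := by
  have := matchingNumber_le_add_card (G := G) (G' := core G) (U := U) fun a b hab => by
    by_cases hc : (core G).Adj a b
    · exact Or.inl hc
    · exact Or.inr (h.2.1 a b hab hc)
  have := h.2.2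
  omega

theorem BridgeCover.erase [DecidableEq V] {U : Finset V} {u : V} (hu : u ∈ U)
    (h : BridgeCover G U) : BridgeCover (G.deleteIncidenceSet u) (U.erase u) := by
  obtain ⟨h1, h2, h3⟩ := h
  have hcore := core_deleteIncidenceSet (h1 u hu)
  refine ⟨fun v hv => ?_, fun a b hab hc => ?_, ?_⟩
  · rw [hcore]
    exact h1 v (Finset.mem_of_mem_erase hv)
  · rw [hcore] at hc
    rw [SimpleGraph.deleteIncidenceSet_adj] at hab
    exact (h2 a b hab.1 hc).imp (fun h => Finset.mem_erase.2 ⟨hab.2.1, h⟩)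
      (fun h => Finset.mem_erase.2 ⟨hab.2.2, h⟩)
  · have h4 : matchingNumber (acyclicPart G) ≤
        matchingNumber (acyclicPart (G.deleteIncidenceSet u)) + 1 := by
      refine matchingNumber_le_add_card (U := {u}) fun a b hab => ?_
      by_cases ha : a = u
      · exact Or.inr (Or.inl (by simpa using ha))
      by_cases hb : b = u
      · exact Or.inr (Or.inr (by simpa using hb))
      left
      refine ⟨SimpleGraph.deleteIncidenceSet_adj.2 ⟨hab.1, ha, hb⟩, ?_, ?_⟩
      · rw [hcore]
        exact hab.2.1
      · rw [hcore]
        exact hab.2.2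
    rw [Finset.card_erase_of_mem hu]
    omega

/-- A maximum matching of the acyclic part pairs each vertex of a bridge cover `U` with a vertex
outside `U`. -/
theorem BridgeCover.exists_partner {U : Finset V} (h : BridgeCover G U) :
    ∃ π : V → V, (∀ u ∈ U, (acyclicPart G).Adj u (π u) ∧ π u ∉ U) ∧
      ∀ u ∈ U, ∀ v ∈ U, π u = π v → u = v := by
  classical
  obtain ⟨h1, h2, h3⟩ := h
  obtain ⟨M, ⟨hM1, hM2⟩, hM⟩ := exists_isMatchSet (acyclicPart G)
  have hex : ∀ e : Sym2 V, ∃ v, e ∈ M → v ∈ U ∧ v ∈ e := by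
    intro e
    induction e with
    | _ a b =>
      by_cases he : s(a, b) ∈ M
      · have hab : (acyclicPart G).Adj a b := hM1 _ he
        rcases h2 a b hab.1 (fun hc => hab.2.1 ⟨b, hc⟩) with h | h
        · exact ⟨a, fun _ => ⟨h, Sym2.mem_mk_left _ _⟩⟩
        · exact ⟨b, fun _ => ⟨h, Sym2.mem_mk_right _ _⟩⟩
      · exact ⟨a, fun h => (he h).elim⟩
  choose φ hφ using hex
  have hinj : Set.InjOn φ M := fun e he f hf hef =>
    hM2 e he f hf (φ e) (hφ e he).2 (hef ▸ (hφ f hf).2)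
  have hsurj := Finset.surj_on_of_inj_on_of_card_le (s := M) (t := U) (fun e _ => φ e)
    (fun e he => (hφ e he).1) (fun e f he hf hef => hinj he hf hef) (by omega)
  have hpartner : ∀ u, ∃ w, u ∈ U → s(u, w) ∈ M ∧ w ∉ U := by
    intro u
    by_cases hu : u ∈ U
    · obtain ⟨e, he, rfl⟩ := hsurj u hu
      obtain ⟨w, hw⟩ := (hφ e he).2
      refine ⟨w, fun _ => ⟨hw ▸ he, fun hwU => ?_⟩⟩
      obtain ⟨f, hf, hfw⟩ := hsurj w hwU
      have hef : e = f := hM2 e he f hf w (by rw [hw]; exact Sym2.mem_mk_right _ _)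
        (hfw ▸ (hφ f hf).2)
      have hadj : (acyclicPart G).Adj (φ e) w := by
        have := hM1 e he
        rw [hw] at this
        exact this
      rw [← hef] at hfw
      exact hadj.ne hfw.symm
    · exact ⟨u, fun h => (hu h).elim⟩
  choose π hπ using hpartner
  refine ⟨π, fun u hu => ⟨hM1 _ (hπ u hu).1, (hπ u hu).2⟩, fun u hu v hv huv => ?_⟩
  have := hM2 _ (hπ u hu).1 _ (hπ v hv).1 (π u) (Sym2.mem_mk_right _ _)
    (huv ▸ Sym2.mem_mk_right _ _)
  rw [huv] at this
  exact Sym2.congr_left.1 this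

/-- If no partner of a vertex of `U` were pendant, then one could walk forever along bridges,
alternately from a partner to a new vertex of `U` and on to the partner of that vertex. -/
theorem BridgeCover.exists_pendant {U : Finset V} (h : BridgeCover G U) (hU : U.Nonempty) :
    ∃ u ∈ U, ∃ u', G.Adj u u' ∧ ∀ z, G.Adj u' z → z = u := by
  obtain ⟨π, hπ, hinj⟩ := h.exists_partner
  obtain ⟨-, hcov, -⟩ := h
  by_contra! hno
  -- the next vertex of the walk
  have hnext : ∀ y ∈ U, ∃ z ∈ U, z ≠ y ∧ G.Adj (π y) z ∧ ¬ (core G).Adj (π y) z := by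
    intro y hy
    obtain ⟨hadj, hyU⟩ := hπ y hy
    obtain ⟨z, hz, hzy⟩ := hno y hy (π y) hadj.1
    have hc : ¬ (core G).Adj (π y) z := fun hc => hadj.2.2 ⟨z, hc⟩
    exact ⟨z, (hcov _ _ hz hc).resolve_left hyU, hzy, hz, hc⟩
  have key : ∀ k, ∀ w y, G.Adj w y → y ∈ U → w ≠ π y →
      {t | (G.deleteEdges {s(y, w)}).Reachable y t}.ncard = k → False := by
    intro k
    induction k using Nat.strong_induction_on with
    | _ k ih =>
      intro w y hwy hy hw hk
      obtain ⟨z, hz, hzy, hadj, hc⟩ := hnext y hy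
      have hyy := (hπ y hy).1.1
      have hbridge : ¬ (G.deleteEdges {s(z, π y)}).Reachable z (π y) := fun hr =>
        hc (core_adj_iff.2 ⟨hadj.symm, hr⟩).symm
      have hyside : ¬ (G.deleteEdges {s(z, π y)}).Reachable z y := by
        refine fun hr => hbridge (hr.trans (SimpleGraph.Adj.reachable ?_))
        rw [SimpleGraph.deleteEdges_adj]
        refine ⟨hyy, fun he => ?_⟩
        exact hzy (Sym2.congr_left.1 (Set.mem_singleton_iff.1 he)).symm
      refine ih _ ?_ (π y) z hadj hz (fun he => hzy (hinj y hy z hz he).symm) rfl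
      rw [← hk]
      refine Set.ncard_lt_ncard ⟨fun t ht => ?_, fun hsub => hyside (hsub ?_)⟩ (Set.toFinite _)
      · have h1 : (G.deleteEdges {s(y, w)}).Reachable y (π y) := by
          refine SimpleGraph.Adj.reachable ?_
          rw [SimpleGraph.deleteEdges_adj]
          exact ⟨hyy, fun he => hw (Sym2.congr_right.1 (Set.mem_singleton_iff.1 he)).symm⟩
        have h2 : (G.deleteEdges {s(y, w)}).Reachable (π y) z := by
          refine SimpleGraph.Adj.reachable ?_
          rw [SimpleGraph.deleteEdges_adj]
          refine ⟨hadj, fun he => ?_⟩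
          rcases Sym2.eq_iff.1 (Set.mem_singleton_iff.1 he) with ⟨h', -⟩ | ⟨-, h'⟩
          · exact hyy.ne h'.symm
          · exact hzy h'
        refine (h1.trans h2).trans (reachable_deleteEdges_of_avoid (e := s(z, π y)) ?_ ht)
        rintro t ht rfl
        exact hyside ht
      · exact SimpleGraph.Reachable.refl _
  obtain ⟨u, hu⟩ := hU
  obtain ⟨z, hz, hzu, hadj, -⟩ := hnext u hu
  exact key _ (π u) z hadj hz (fun he => hzu (hinj u hu z hz he).symm) rfl

end Certificates

/-! ### Extremal graphs -/

section Extremal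

variable {V : Type*} {C G : SimpleGraph V} {n : ℕ}

/-- The edges of `G` that avoid the vertices of `C`. -/
def avoiding (G C : SimpleGraph V) : SimpleGraph V where
  Adj a b := G.Adj a b ∧ a ∉ C.support ∧ b ∉ C.support
  symm := ⟨fun _ _ ⟨h, ha, hb⟩ => ⟨h.symm, hb, ha⟩⟩
  loopless := ⟨fun _ h => h.1.ne rfl⟩

theorem avoiding_le (G C : SimpleGraph V) : avoiding G C ≤ G := fun _ _ h => h.1

theorem avoiding_disjoint (G C : SimpleGraph V) :
    Disjoint (avoiding G C).support C.support := by
  rw [Set.disjoint_left]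
  rintro a ⟨b, hb⟩
  exact hb.2.1

/-- A cycle attached to the rest of `G` by the single edge `xy`. -/
structure IsLeafCycle (G C : SimpleGraph V) (n : ℕ) (x y : V) : Prop where
  isCyc : IsCyc C n
  le : C ≤ G
  adj : G.Adj x y
  mem : x ∈ C.support
  notMem : y ∉ C.support
  adj_or : ∀ a b, a ∈ C.support → G.Adj a b → C.Adj a b ∨ (a = x ∧ b = y)

theorem CycleCriterion.of_deleteIncidenceSet (hdisj : DisjointCycles G) {y : V}
    (hy : y ∉ (core G).support) (h : CycleCriterion (G.deleteIncidenceSet y))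
    (hm : matchingNumber (acyclicPart (G.deleteIncidenceSet y)) + 1 ≤
      matchingNumber (acyclicPart G)) : CycleCriterion G := by
  classical
  obtain ⟨-, hlen, U, hU⟩ := h
  refine ⟨hdisj, fun C n hC hCG => hlen C n hC (IsCyc.le_deleteIncidenceSet hCG fun h => ?_),
    insert y U, hU.insert hy hm⟩
  exact hy (SimpleGraph.support_mono (hC.le_core hCG) h)

theorem bridgeCover_empty (h : ∀ a b, G.Adj a b → (core G).Adj a b) : BridgeCover G ∅ :=
  ⟨by simp, fun a b hab hc => (hc (h a b hab)).elim, by simp⟩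

variable [Fintype V]

/-- `G` attains the upper bound `p ≤ m + c` for the positive inertia index. -/
def IsExtremal (G : SimpleGraph V) : Prop :=
  (inertia G : ℤ) = matchingNumber G + cyclomaticNumber G

/-- Deleting a vertex of a cycle lowers `c` by at least one and `p` by at most one, so that in an
extremal graph both drop by exactly one, while `m` does not change. -/
theorem IsExtremal.deleteIncidenceSet_of_mem_core (hG : IsExtremal G) {x : V}
    (hx : x ∈ (core G).support) :
    IsExtremal (G.deleteIncidenceSet x) ∧
      matchingNumber (G.deleteIncidenceSet x) = matchingNumber G ∧
      cyclomaticNumber (G.deleteIncidenceSet x) + 1 = cyclomaticNumber G := by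
  have h1 := inertia_le_deleteIncidenceSet G x
  have h2 := inertia_le_matchingNumber_add (G.deleteIncidenceSet x)
  have h3 := matchingNumber_mono (G.deleteIncidenceSet_le x)
  have h4 := cyclomaticNumber_deleteIncidenceSet_lt hx
  unfold IsExtremal at *
  refine ⟨?_, ?_, ?_⟩ <;> omega

theorem IsExtremal.deleteIncidenceSet_of_notMem_core (hG : IsExtremal G) {y : V}
    (hy : y ∉ (core G).support)
    (hm : matchingNumber (G.deleteIncidenceSet y) + 1 ≤ matchingNumber G) :
    IsExtremal (G.deleteIncidenceSet y) := by
  have h1 := inertia_le_deleteIncidenceSet G y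
  have h2 := inertia_le_matchingNumber_add (G.deleteIncidenceSet y)
  have h3 := cyclomaticNumber_deleteIncidenceSet_of_notMem hy
  unfold IsExtremal at *
  omega

/-- If distinct cycles `C` and `D` meet, then an edge of `C` can be deleted at some vertex `a` of
`D` without destroying `D`, so that deleting `a` lowers the cyclomatic number by at least two. -/
theorem IsExtremal.disjointCycles (hG : IsExtremal G) : DisjointCycles G := by
  intro C D n m hC hD hCG hDG hne
  rw [Set.disjoint_left]
  intro x hxC hxD
  refine hne (hC.eq_of_forall_adj hD hxC hxD fun a haC haD z hz => ?_)
  by_contra hDz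
  have h1 := cyclomaticNumber_deleteEdges_of_core (G := G) ⟨C, n, hC, hCG, hz⟩
  have hD' : D ≤ G.deleteEdges {s(a, z)} := le_deleteEdges hDG hDz
  have h2 := cyclomaticNumber_deleteIncidenceSet_lt (G := G.deleteEdges {s(a, z)}) (x := a)
    (mem_support_core.2 ⟨D, m, hD, hD', haD⟩)
  have h3 : (G.deleteEdges {s(a, z)}).deleteIncidenceSet a = G.deleteIncidenceSet a := by
    ext p q
    simp only [SimpleGraph.deleteIncidenceSet_adj, SimpleGraph.deleteEdges_adj,
      Set.mem_singleton_iff]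
    constructor
    · rintro ⟨⟨h, -⟩, h'⟩
      exact ⟨h, h'⟩
    · rintro ⟨h, hp, hq⟩
      refine ⟨⟨h, fun he => ?_⟩, hp, hq⟩
      rcases Sym2.eq_iff.1 he with ⟨h', -⟩ | ⟨-, h'⟩
      · exact hp h'
      · exact hq h'
  rw [h3] at h2
  have h4 := (hG.deleteIncidenceSet_of_mem_core (x := a)
    (mem_support_core.2 ⟨C, n, hC, hCG, haC⟩)).2.2
  omega

/-- In an extremal graph no edge joins two different cycles `C` and `D ∋ y`: the vertices `x` and
`y` can be deleted without lowering the matching number. -/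
theorem IsExtremal.notMem_core_of_leaf (hG : IsExtremal G) (hC : IsCyc C n) (hCG : C ≤ G) {x y : V}
    (hxy : G.Adj x y) (hx : x ∈ C.support) (hy : y ∉ C.support) : y ∉ (core G).support := by
  intro hyG
  have hx' : x ∈ (core G).support := SimpleGraph.support_mono (hC.le_core hCG) hx
  obtain ⟨hE, hm, -⟩ := hG.deleteIncidenceSet_of_mem_core hx'
  have hy' := hG.disjointCycles.mem_core_deleteIncidenceSet hC hCG hx hy hyG
  obtain ⟨-, hm', -⟩ := hE.deleteIncidenceSet_of_mem_core hy'
  have := matchingNumber_add_one_le (G' := (G.deleteIncidenceSet x).deleteIncidenceSet y)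
    (((G.deleteIncidenceSet x).deleteIncidenceSet_le y).trans (G.deleteIncidenceSet_le x)) hxy
    (fun h => notMem_support_deleteIncidenceSet G x
      (SimpleGraph.support_mono (SimpleGraph.deleteIncidenceSet_le _ y) h))
    (notMem_support_deleteIncidenceSet _ y)
  omega

/-- If `n` is even, then `C` has a perfect matching, hence `m(G - x) < m(G)`. -/
theorem IsLeafCycle.odd {x y : V} (h : IsLeafCycle G C n x y) (hG : IsExtremal G) :
    n % 2 = 1 := by
  obtain ⟨hC, hCG, hxy, hx, hy, hout⟩ := h
  have hx' : x ∈ (core G).support := SimpleGraph.support_mono (hC.le_core hCG) hx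
  obtain ⟨-, hm, -⟩ := hG.deleteIncidenceSet_of_mem_core hx'
  have h1 := matchingNumber_le_add (G := G.deleteIncidenceSet x) (G₁ := avoiding G C)
    (G₂ := C.deleteIncidenceSet x) (by
      intro a b hab
      rw [SimpleGraph.deleteIncidenceSet_adj] at hab
      obtain ⟨hab, hax, hbx⟩ := hab
      by_cases ha : a ∈ C.support
      · rcases hout a b ha hab with h | ⟨h, -⟩
        · exact Or.inr (SimpleGraph.deleteIncidenceSet_adj.2 ⟨h, hax, hbx⟩)
        · exact (hax h).elim
      by_cases hb : b ∈ C.support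
      · rcases hout b a hb hab.symm with h | ⟨h, -⟩
        · exact Or.inr (SimpleGraph.deleteIncidenceSet_adj.2 ⟨h.symm, hax, hbx⟩)
        · exact (hbx h).elim
      exact Or.inl ⟨hab, ha, hb⟩)
  have h2 := hC.two_mul_matchingNumber_deleteIncidenceSet_le hx
  have h3 := matchingNumber_add_le (avoiding_le G C) hCG (avoiding_disjoint G C)
  have h4 := hC.le_matchingNumber
  obtain ⟨g, hg⟩ := hC
  have := hg.1
  omega

/-- If `n` is odd, then `C - x` has a perfect matching, to which `xy` can be added. -/
theorem IsLeafCycle.matchingNumber_lt {x y : V} (h : IsLeafCycle G C n x y) (hn : n % 2 = 1) :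
    matchingNumber (G.deleteIncidenceSet y) + 1 ≤ matchingNumber G := by
  obtain ⟨hC, hCG, hxy, hx, hy, hout⟩ := h
  have h1 := matchingNumber_le_add (G := G.deleteIncidenceSet y)
    (G₁ := (avoiding G C).deleteIncidenceSet y) (G₂ := C) (by
      intro a b hab
      rw [SimpleGraph.deleteIncidenceSet_adj] at hab
      obtain ⟨hab, hay, hby⟩ := hab
      by_cases ha : a ∈ C.support
      · rcases hout a b ha hab with h | ⟨-, h⟩
        · exact Or.inr h
        · exact (hby h).elim
      by_cases hb : b ∈ C.support
      · rcases hout b a hb hab.symm with h | ⟨-, h⟩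
        · exact Or.inr h.symm
        · exact (hay h).elim
      exact Or.inl (SimpleGraph.deleteIncidenceSet_adj.2 ⟨⟨hab, ha, hb⟩, hay, hby⟩))
  have h2 := hC.two_mul_matchingNumber_le
  have h3 := hC.le_matchingNumber_deleteIncidenceSet hx
  have hsub : (avoiding G C).deleteIncidenceSet y ≤ avoiding G C :=
    SimpleGraph.deleteIncidenceSet_le _ _
  have h4 := matchingNumber_add_le
    (G := (avoiding G C).deleteIncidenceSet y ⊔ C.deleteIncidenceSet x) le_sup_left le_sup_right
    ((avoiding_disjoint G C).mono (SimpleGraph.support_mono hsub)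
      (SimpleGraph.support_mono (C.deleteIncidenceSet_le x)))
  have h5 := matchingNumber_add_one_le
    (G' := (avoiding G C).deleteIncidenceSet y ⊔ C.deleteIncidenceSet x)
    (sup_le (hsub.trans (avoiding_le G C)) ((C.deleteIncidenceSet_le x).trans hCG)) hxy
    (by
      rintro ⟨z, hz | hz⟩
      · exact (hsub hz).2.1 hx
      · exact (SimpleGraph.deleteIncidenceSet_adj.1 hz).2.1 rfl)
    (by
      rintro ⟨z, hz | hz⟩
      · exact (SimpleGraph.deleteIncidenceSet_adj.1 hz).2.1 rfl
      · exact hy ⟨z, C.deleteIncidenceSet_le x hz⟩)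
  omega

/-- The matching needed to extend a bridge cover of `G - y` by `y`, found by comparing the
decompositions `m = m(acyclic part) + m(core)` for `G - x` and `G - y`, where `m(G - x) = m(G)` and
`m(G - y) < m(G)`. -/
theorem IsLeafCycle.matchingNumber_acyclicPart_lt {x y : V} (h : IsLeafCycle G C n x y)
    (hn : n % 2 = 1) (hdisj : DisjointCycles G) (hy : y ∉ (core G).support)
    (hm : matchingNumber (G.deleteIncidenceSet x) = matchingNumber G)
    {U : Finset V} (hU : BridgeCover (G.deleteIncidenceSet x) U) :
    matchingNumber (acyclicPart (G.deleteIncidenceSet y)) + 1 ≤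
      matchingNumber (acyclicPart G) := by
  have h0 := h.matchingNumber_lt hn
  obtain ⟨hC, hCG, hxy, hx, hyC, hout⟩ := h
  have h1 := matchingNumber_acyclicPart_add_core_le (G.deleteIncidenceSet y)
  rw [core_deleteIncidenceSet hy] at h1
  have h2 := hU.matchingNumber_le
  have h3 := matchingNumber_add_le (G := core G) (core_mono (G.deleteIncidenceSet_le x))
    ((C.deleteIncidenceSet_le x).trans (hC.le_core hCG))
    ((hdisj.core_deleteIncidenceSet_disjoint hC hCG hx).mono_right
      (SimpleGraph.support_mono (C.deleteIncidenceSet_le x)))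
  have h4 := hC.le_matchingNumber_deleteIncidenceSet hx
  have h5 := hC.two_mul_matchingNumber_deleteIncidenceSet_le hx
  have h6 := matchingNumber_le_add (G := acyclicPart (G.deleteIncidenceSet x))
    (G₁ := acyclicPart G) (G₂ := C.deleteIncidenceSet x) (by
      rintro a b ⟨hab, ha', hb'⟩
      rw [SimpleGraph.deleteIncidenceSet_adj] at hab
      obtain ⟨hab, hax, hbx⟩ := hab
      by_cases ha : a ∈ C.support
      · rcases hout a b ha hab with h | ⟨h, -⟩
        · exact Or.inr (SimpleGraph.deleteIncidenceSet_adj.2 ⟨h, hax, hbx⟩)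
        · exact (hax h).elim
      by_cases hb : b ∈ C.support
      · rcases hout b a hb hab.symm with h | ⟨h, -⟩
        · exact Or.inr (SimpleGraph.deleteIncidenceSet_adj.2 ⟨h.symm, hax, hbx⟩)
        · exact (hbx h).elim
      exact Or.inl ⟨hab, fun h => ha' (hdisj.mem_core_deleteIncidenceSet hC hCG hx ha h),
        fun h => hb' (hdisj.mem_core_deleteIncidenceSet hC hCG hx hb h)⟩)
  omega

theorem matchingNumber_acyclicPart_pendant {x y : V} (hxy : G.Adj x y)
    (hp : ∀ z, G.Adj x z → z = y) (hy : y ∉ (core G).support) :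
    matchingNumber (acyclicPart (G.deleteIncidenceSet y)) + 1 ≤
      matchingNumber (acyclicPart G) := by
  have hx : x ∉ (core G).support := by
    rintro ⟨z, hz⟩
    have hz' : (core G).Adj x z := hz
    rw [hp z (core_le G hz')] at hz'
    exact hy ⟨x, hz'.symm⟩
  refine matchingNumber_add_one_le (x := x) (y := y) ?_ ⟨hxy, hx, hy⟩ ?_ ?_
  · rintro a b ⟨hab, ha, hb⟩
    rw [core_deleteIncidenceSet hy] at ha hb
    exact ⟨G.deleteIncidenceSet_le y hab, ha, hb⟩
  · rintro ⟨z, hz, -⟩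
    rw [SimpleGraph.deleteIncidenceSet_adj] at hz
    exact hz.2.2 (hp z hz.1)
  · rintro ⟨z, hz, -⟩
    rw [SimpleGraph.deleteIncidenceSet_adj] at hz
    exact hz.2.1 rfl

/-- A bridgeless extremal graph is a disjoint union of cycles, each of which has to contribute more
than half its length. -/
theorem IsExtremal.length_of_bridgeless (hG : IsExtremal G)
    (hcore : ∀ a b, G.Adj a b → (core G).Adj a b) (hC : IsCyc C n) (hCG : C ≤ G) : n % 4 = 1 := by
  by_contra hn
  have h1 := hC.inertia_le_sdiff_add hn hCG
  have h2 := inertia_le_matchingNumber_add (G \ C)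
  have h3 := matchingNumber_add_le (G := G) sdiff_le hCG
    (hG.disjointCycles.sdiff_disjoint hC hCG hcore)
  have h4 := hC.le_matchingNumber
  have h5 := cyclomaticNumber_sdiff_lt hC hCG
  unfold IsExtremal at hG
  omega

/-- Induction on the number of edges, isolating the endpoint `y` of an extremal bridge `xy`. -/
theorem IsExtremal.cycleCriterion (hG : IsExtremal G) : CycleCriterion G := by
  induction hk : Nat.card G.edgeSet using Nat.strong_induction_on generalizing G with
  | _ k ih =>
    have hdisj := hG.disjointCycles
    by_cases hbr : ∃ a b, G.Adj a b ∧ ¬ (core G).Adj a b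
    · obtain ⟨x, y, hxy, -, hp | ⟨C, n, hC, hCG, hx, hy, hout⟩⟩ :=
        exists_pendant_or_leaf_cycle hdisj hbr
      · have hm := matchingNumber_pendant hxy hp
        have hy : y ∉ (core G).support := by
          intro hy
          have := (hG.deleteIncidenceSet_of_mem_core hy).2.1
          omega
        exact CycleCriterion.of_deleteIncidenceSet hdisj hy
          (ih _ (hk ▸ card_edgeSet_deleteIncidenceSet_lt hxy)
            (hG.deleteIncidenceSet_of_notMem_core hy hm) rfl)
          (matchingNumber_acyclicPart_pendant hxy hp hy)
      · have hleaf : IsLeafCycle G C n x y := ⟨hC, hCG, hxy, hx, hy, hout⟩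
        have hodd := hleaf.odd hG
        have hyG := hG.notMem_core_of_leaf hC hCG hxy hx hy
        have hx' : x ∈ (core G).support := SimpleGraph.support_mono (hC.le_core hCG) hx
        obtain ⟨hEx, hmx, -⟩ := hG.deleteIncidenceSet_of_mem_core hx'
        obtain ⟨-, -, U, hU⟩ := ih _ (hk ▸ card_edgeSet_deleteIncidenceSet_lt hxy.symm) hEx rfl
        exact CycleCriterion.of_deleteIncidenceSet hdisj hyG
          (ih _ (hk ▸ card_edgeSet_deleteIncidenceSet_lt hxy)
            (hG.deleteIncidenceSet_of_notMem_core hyG (hleaf.matchingNumber_lt hodd)) rfl)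
          (hleaf.matchingNumber_acyclicPart_lt hodd hdisj hyG hmx hU)
    · push Not at hbr
      exact ⟨hdisj, fun C n hC hCG => hG.length_of_bridgeless hbr hC hCG, ∅,
        bridgeCover_empty hbr⟩

/-- Induction on the number of edges: the vertices of the bridge cover are isolated one by one, then
the cycles are removed one by one. -/
theorem CycleCriterion.isExtremal (hG : CycleCriterion G) : IsExtremal G := by
  classical
  induction hk : Nat.card G.edgeSet using Nat.strong_induction_on generalizing G with
  | _ k ih =>
    obtain ⟨hdisj, hlen, U, hU⟩ := hG
    -- only the lower bound `m + c ≤ p` needs an argument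
    have hub := inertia_le_matchingNumber_add G
    rcases U.eq_empty_or_nonempty with rfl | hne
    · have hcore : ∀ a b, G.Adj a b → (core G).Adj a b := by
        intro a b hab
        by_contra hc
        simpa using hU.2.1 a b hab hc
      by_cases hbot : ∃ a b, G.Adj a b
      · obtain ⟨a, b, hab⟩ := hbot
        obtain ⟨C, n, hC, hCG, hCab⟩ := hcore a b hab
        have hd := hdisj.sdiff_disjoint hC hCG hcore
        have hn := hlen C n hC hCG
        have hrest : CycleCriterion (G \ C) := by
          refine ⟨hdisj.mono sdiff_le, fun D m hD hDG => hlen D m hD (hDG.trans sdiff_le), ∅,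
            bridgeCover_empty ?_⟩
          rintro p q ⟨hpq, hCpq⟩
          obtain ⟨D, m, hD, hDG, hDpq⟩ := hcore p q hpq
          have hCD : C ≠ D := by
            rintro rfl
            exact hCpq hDpq
          refine ⟨D, m, hD, fun r s hrs => ⟨hDG hrs, fun hCrs => ?_⟩, hDpq⟩
          exact Set.disjoint_left.1 (hdisj C D n m hC hD hCG hDG hCD) ⟨s, hCrs⟩ ⟨s, hrs⟩
        have hlt : Nat.card (G \ C).edgeSet < Nat.card G.edgeSet :=
          card_edgeSet_lt sdiff_le hab fun h => h.2 hCab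
        have h1 := ih _ (hk ▸ hlt) hrest rfl
        have h2 := hC.inertia_sdiff_add_le hn hCG hd
        have h3 := matchingNumber_le_add (G := G) (G₁ := G \ C) (G₂ := C) (fun p q hpq => by
          by_cases hCpq : C.Adj p q
          · exact Or.inr hCpq
          · exact Or.inl ⟨hpq, hCpq⟩)
        have h4 := hC.two_mul_matchingNumber_le
        have h5 := cyclomaticNumber_le_sdiff_add_one hC hCG
          (fun D m hD hDG hne => hdisj C D n m hC hD hCG hDG hne)
        unfold IsExtremal at *
        omega
      · have hGbot : G = ⊥ := by
          ext a b
          simpa using fun hab => hbot ⟨a, b, hab⟩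
        have hm : matchingNumber G ≤ 0 := matchingNumber_le_card_of_cover (U := ∅)
          fun a b hab => (hbot ⟨a, b, hab⟩).elim
        have hc : cyclomaticNumber G = 0 := by rw [hGbot, cyclomaticNumber_bot]
        unfold IsExtremal
        omega
    · obtain ⟨u, hu, u', huu', hp⟩ := hU.exists_pendant hne
      have huG := hU.1 u hu
      have hle := G.deleteIncidenceSet_le u
      have h1 := ih _ (hk ▸ card_edgeSet_deleteIncidenceSet_lt huu'.symm)
        ⟨hdisj.mono hle, fun D m hD hDG => hlen D m hD (hDG.trans hle), _, hU.erase hu⟩ rfl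
      have h2 := inertia_pendant G huu' hp
      have h3 := matchingNumber_le_deleteIncidenceSet G u
      have h4 := cyclomaticNumber_deleteIncidenceSet_of_notMem huG
      unfold IsExtremal at *
      omega

theorem isExtremal_iff_cycleCriterion : IsExtremal G ↔ CycleCriterion G :=
  ⟨IsExtremal.cycleCriterion, CycleCriterion.isExtremal⟩

end Extremal

/-! ### Cycles as walks and the contraction -/

section Contraction

variable {V : Type*} {G : SimpleGraph V} {n : ℕ}

theorem verts_eq_support_of_isCycle {v : V} (p : G.Walk v v) (hp : p.IsCycle) :
    p.toSubgraph.verts = p.toSubgraph.spanningCoe.support := by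
  have h3 := hp.three_le_length
  ext w
  constructor
  · intro hw
    rw [SimpleGraph.Walk.mem_verts_toSubgraph,
      SimpleGraph.Walk.mem_support_iff_exists_getVert] at hw
    obtain ⟨i, rfl, hi⟩ := hw
    rcases Nat.lt_or_ge i p.length with h | h
    · refine ⟨p.getVert (i + 1), ?_⟩
      exact (SimpleGraph.Walk.toSubgraph_adj_iff p).2 ⟨i, rfl, h⟩
    · refine ⟨p.getVert (i - 1), ?_⟩
      refine (SimpleGraph.Walk.toSubgraph_adj_iff p).2 ⟨i - 1, ?_, by omega⟩
      rw [Nat.sub_add_cancel (by omega)]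
      exact Sym2.eq_swap
  · rintro ⟨u, hu⟩
    exact p.toSubgraph.edge_vert hu

theorem IsCycleSubgraph.exists_isCyc {C : G.Subgraph} (h : IsCycleSubgraph G C) :
    (∃ n, IsCyc C.spanningCoe n) ∧ C.verts = C.spanningCoe.support := by
  obtain ⟨v, p, hp, rfl⟩ := h
  exact ⟨⟨_, isCyc_of_isCycle p hp⟩, verts_eq_support_of_isCycle p hp⟩

theorem IsCyc.exists_isCycleSubgraph {C : SimpleGraph V} (hC : IsCyc C n) (hCG : C ≤ G) :
    ∃ D : G.Subgraph, IsCycleSubgraph G D ∧ D.spanningCoe = C ∧ D.verts = C.support := by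
  obtain ⟨v, p, hp, rfl, -⟩ := hC.exists_walk hCG
  exact ⟨_, ⟨v, p, hp, rfl⟩, rfl, verts_eq_support_of_isCycle p hp⟩

theorem cyclesDisjoint_iff : CyclesDisjoint G ↔ DisjointCycles G := by
  constructor
  · intro h C D n m hC hD hCG hDG hne
    obtain ⟨C', hC', rfl, hv⟩ := hC.exists_isCycleSubgraph hCG
    obtain ⟨D', hD', rfl, hw⟩ := hD.exists_isCycleSubgraph hDG
    rw [← hv, ← hw]
    refine h C' D' hC' hD' ?_
    rintro rfl
    exact hne rfl
  · intro h C D hC hD hne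
    obtain ⟨⟨n, hC'⟩, hv⟩ := hC.exists_isCyc
    obtain ⟨⟨m, hD'⟩, hw⟩ := hD.exists_isCyc
    rw [hv, hw]
    refine h _ _ n m hC' hD' C.spanningCoe_le D.spanningCoe_le fun heq => hne ?_
    refine SimpleGraph.Subgraph.ext (by rw [hv, hw, heq]) ?_
    funext a b
    exact congrFun (congrFun (congrArg SimpleGraph.Adj heq) a) b

theorem forall_length_iff :
    (∀ (v : V) (p : G.Walk v v), p.IsCycle → p.length ≡ 1 [MOD 4]) ↔
      ∀ C n, IsCyc C n → C ≤ G → n % 4 = 1 := by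
  constructor
  · intro h C n hC hCG
    obtain ⟨v, p, hp, -, rfl⟩ := hC.exists_walk hCG
    exact h v p hp
  · intro h v p hp
    exact h _ _ (isCyc_of_isCycle p hp) p.toSubgraph.spanningCoe_le

theorem onCommonCycle_iff {v w : V} :
    OnCommonCycle G v w ↔ ∃ C n, IsCyc C n ∧ C ≤ G ∧ v ∈ C.support ∧ w ∈ C.support := by
  constructor
  · rintro ⟨C, hC, hv, hw⟩
    obtain ⟨⟨n, hC'⟩, hverts⟩ := hC.exists_isCyc
    exact ⟨_, n, hC', C.spanningCoe_le, hverts ▸ hv, hverts ▸ hw⟩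
  · rintro ⟨C, n, hC, hCG, hv, hw⟩
    obtain ⟨D, hD, -, hverts⟩ := hC.exists_isCycleSubgraph hCG
    exact ⟨D, hD, hverts ▸ hv, hverts ▸ hw⟩

/-- The vertex of the contraction that `v` becomes. -/
def classOf (G : SimpleGraph V) (v : V) : ContractedVertex G := Quot.mk _ v

theorem classOf_surjective : Function.Surjective (classOf G) := Quot.mk_surjective

theorem classOf_mem_cyclicVertices_of_mem_core {v : V} (hv : v ∈ (core G).support) :
    classOf G v ∈ cyclicVertices G := by
  obtain ⟨C, n, hC, hCG, hvC⟩ := mem_support_core.1 hv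
  obtain ⟨D, hD, -, hverts⟩ := hC.exists_isCycleSubgraph hCG
  exact ⟨D, hD, v, hverts ▸ hvC, rfl⟩

/-- A vertex on no cycle is alone in its class. -/
theorem eq_of_classOf_eq {v w : V} (hv : v ∉ (core G).support)
    (h : classOf G v = classOf G w) : v = w := by
  classical
  let F : ContractedVertex G → Option V :=
    Quot.lift (fun u => if u ∈ (core G).support then none else some u) (by
      intro a b hab
      obtain ⟨C, n, hC, hCG, ha, hb⟩ := onCommonCycle_iff.1 hab
      rw [if_pos (mem_support_core.2 ⟨C, n, hC, hCG, ha⟩),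
        if_pos (mem_support_core.2 ⟨C, n, hC, hCG, hb⟩)])
  have hF : (if v ∈ (core G).support then none else some v) =
      (if w ∈ (core G).support then none else some w) := congrArg F h
  rw [if_neg hv] at hF
  split_ifs at hF
  exact Option.some.inj hF

theorem classOf_mem_cyclicVertices_iff {v : V} :
    classOf G v ∈ cyclicVertices G ↔ v ∈ (core G).support := by
  refine ⟨?_, classOf_mem_cyclicVertices_of_mem_core⟩
  rintro ⟨C, hC, w, hw, hwv⟩
  by_contra hv
  obtain ⟨⟨n, hC'⟩, hverts⟩ := hC.exists_isCyc
  rw [← eq_of_classOf_eq hv hwv.symm, hverts] at hw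
  exact hv (SimpleGraph.support_mono (hC'.le_core C.spanningCoe_le) hw)

theorem classOf_eq_of_core_adj {a b : V} (h : (core G).Adj a b) :
    classOf G a = classOf G b := by
  obtain ⟨C, n, hC, hCG, hab⟩ := h
  exact Quot.sound (onCommonCycle_iff.2 ⟨C, n, hC, hCG, ⟨b, hab⟩, ⟨a, hab.symm⟩⟩)

/-- The classes are connected by cycles, and these do not use a bridge `xy`. -/
theorem reachable_of_classOf_eq {x y v w : V} (hxy : ¬ (core G).Adj x y)
    (h : classOf G v = classOf G w) :
    (G.deleteEdges {s(x, y)}).Reachable v w := by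
  induction Quot.eqvGen_exact h with
  | rel v w hvw =>
    obtain ⟨C, n, hC, hCG, hv, hw⟩ := onCommonCycle_iff.1 hvw
    exact (hC.reachable hv hw).mono (le_deleteEdges hCG fun hC' => hxy ⟨C, n, hC, hCG, hC'⟩)
  | refl => exact SimpleGraph.Reachable.refl _
  | symm v w hvw ih => exact (ih (Quot.eqvGen_sound hvw)).symm
  | trans u v w huv hvw ih₁ ih₂ =>
    exact (ih₁ (Quot.eqvGen_sound huv)).trans (ih₂ (Quot.eqvGen_sound hvw))

theorem contraction_adj {q r : ContractedVertex G} :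
    (contraction G).Adj q r ↔ q ≠ r ∧ ∃ a b, G.Adj a b ∧ classOf G a = q ∧ classOf G b = r :=
  Iff.rfl

/-- The edges of the contraction come from the bridges of `G`. -/
theorem contraction_adj_classOf {a b : V} (hab : G.Adj a b) (hc : ¬ (core G).Adj a b) :
    (contraction G).Adj (classOf G a) (classOf G b) :=
  contraction_adj.2 ⟨fun h => hc (core_adj_iff.2 ⟨hab, reachable_of_classOf_eq hc h⟩),
    a, b, hab, rfl, rfl⟩

/-- The contraction is a forest: a walk in it that avoids the image of the bridge `xy` lifts to a
walk in `G` that avoids `xy`. -/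
theorem core_contraction : core (contraction G) = ⊥ := by
  ext q r
  refine ⟨fun h => ?_, fun h => h.elim⟩
  obtain ⟨hadj, hreach⟩ := core_adj_iff.1 h
  obtain ⟨hne, x, y, hxy, rfl, rfl⟩ := contraction_adj.1 hadj
  have hc : ¬ (core G).Adj x y := fun hc => hne (classOf_eq_of_core_adj hc)
  have key : ∀ r, ((contraction G).deleteEdges {s(classOf G x, classOf G y)}).Reachable
      (classOf G x) r → ∀ v, classOf G v = r → (G.deleteEdges {s(x, y)}).Reachable x v := by
    intro r hr
    rw [SimpleGraph.reachable_iff_reflTransGen] at hr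
    induction hr with
    | refl => exact fun v hv => reachable_of_classOf_eq hc hv.symm
    | @tail s t _ hst ih =>
      intro v hv
      rw [SimpleGraph.deleteEdges_adj] at hst
      obtain ⟨hst, hne'⟩ := hst
      obtain ⟨-, a, b, hab, rfl, rfl⟩ := contraction_adj.1 hst
      refine ((ih a rfl).trans (SimpleGraph.Adj.reachable ?_)).trans
        (reachable_of_classOf_eq hc hv.symm)
      rw [SimpleGraph.deleteEdges_adj]
      refine ⟨hab, fun he => hne' ?_⟩
      rcases Sym2.eq_iff.1 (Set.mem_singleton_iff.1 he) with ⟨rfl, rfl⟩ | ⟨rfl, rfl⟩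
      · rfl
      · exact Sym2.eq_swap
  exact hc (core_adj_iff.2 ⟨hxy, key _ hreach y rfl⟩)

/-- Kőnig's theorem for forests. -/
theorem exists_cover_of_core_eq_bot [Finite V] (h : core G = ⊥) :
    ∃ U : Finset V, (∀ a b, G.Adj a b → a ∈ U ∨ b ∈ U) ∧ U.card ≤ matchingNumber G := by
  classical
  induction hk : Nat.card G.edgeSet using Nat.strong_induction_on generalizing G with
  | _ k ih =>
    by_cases hne : ∃ a b, G.Adj a b
    · obtain ⟨x, y, hxy, hp⟩ := exists_pendant_of_core_eq_bot h hne
      obtain ⟨U, hU, hcard⟩ := ih _ (hk ▸ card_edgeSet_deleteIncidenceSet_lt hxy)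
        (le_bot_iff.1 (h ▸ core_mono (G.deleteIncidenceSet_le y))) rfl
      have hm := matchingNumber_pendant hxy hp
      refine ⟨insert y U, fun a b hab => ?_, (Finset.card_insert_le y U).trans (by omega)⟩
      by_cases ha : a = y
      · exact Or.inl (ha ▸ Finset.mem_insert_self _ _)
      by_cases hb : b = y
      · exact Or.inr (hb ▸ Finset.mem_insert_self _ _)
      exact (hU a b (SimpleGraph.deleteIncidenceSet_adj.2 ⟨hab, ha, hb⟩)).imp
        Finset.mem_insert_of_mem Finset.mem_insert_of_mem
    · exact ⟨∅, fun a b hab => (hne ⟨a, b, hab⟩).elim, by simp⟩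

variable [Finite V]

instance : Finite (ContractedVertex G) := Finite.of_surjective _ classOf_surjective

theorem matchingNumber_noncyclicPart :
    matchingNumber (noncyclicPart G) = matchingNumber (acyclicPart G) := by
  classical
  let out : ContractedVertex G → V := Function.surjInv classOf_surjective
  have hout_eq : ∀ q, classOf G (out q) = q := Function.surjInv_eq classOf_surjective
  have hout : ∀ (q : ContractedVertex G) (a : V), q ∉ cyclicVertices G → classOf G a = q →
      out q = a := by
    rintro q a hq rfl
    exact (eq_of_classOf_eq (fun h => hq (classOf_mem_cyclicVertices_iff.2 h))
      (hout_eq _).symm).symm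
  apply le_antisymm
  · refine matchingNumber_le_of_injOn (fun q => out q.1) ?_ ?_
    · intro q _ r _ hqr
      have := congrArg (classOf G) hqr
      simp only [hout_eq] at this
      exact Subtype.ext this
    · rintro ⟨q, hq⟩ ⟨r, hr⟩ hqr
      obtain ⟨-, a, b, hab, ha, hb⟩ := contraction_adj.1 hqr
      have hq' : q ∉ cyclicVertices G := hq
      have hr' : r ∉ cyclicVertices G := hr
      simp only [hout q a hq' ha, hout r b hr' hb]
      subst ha hb
      exact ⟨hab, fun h => hq' (classOf_mem_cyclicVertices_iff.2 h),
        fun h => hr' (classOf_mem_cyclicVertices_iff.2 h)⟩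
  · by_cases hne : ∃ v, v ∉ (core G).support
    · obtain ⟨v₀, hv₀⟩ := hne
      let f : V → ((cyclicVertices G)ᶜ : Set (ContractedVertex G)) := fun v =>
        if hv : v ∉ (core G).support then
          ⟨classOf G v, fun h => hv (classOf_mem_cyclicVertices_iff.1 h)⟩
        else ⟨classOf G v₀, fun h => hv₀ (classOf_mem_cyclicVertices_iff.1 h)⟩
      have hf : ∀ v, v ∉ (core G).support → (f v).1 = classOf G v := by
        intro v hv
        simp only [f]
        rw [dif_pos hv]
      refine matchingNumber_le_of_injOn f ?_ ?_
      · rintro a ⟨b, hab⟩ c ⟨d, hcd⟩ hac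
        have := congrArg Subtype.val hac
        rw [hf a hab.2.1, hf c hcd.2.1] at this
        exact eq_of_classOf_eq hab.2.1 this
      · rintro a b ⟨hab, ha, hb⟩
        change (contraction G).Adj (f a).1 (f b).1
        rw [hf a ha, hf b hb]
        exact contraction_adj_classOf hab fun h => ha ⟨b, h⟩
    · refine (matchingNumber_le_card_of_cover (U := ∅) fun a b hab => ?_).trans (by simp)
      exact (hne ⟨a, hab.2.1⟩).elim

/-- By Kőnig's theorem in the forest `T_G`, a maximum matching of `T_G` that avoids the cyclic
vertices forces a minimum vertex cover to avoid them too, and conversely a bridge cover of `G` gives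
a cover of `T_G` that is no larger than a matching of `[T_G]`. -/
theorem exists_bridgeCover_iff :
    (∃ U, BridgeCover G U) ↔
      matchingNumber (contraction G) = matchingNumber (noncyclicPart G) := by
  classical
  have := Fintype.ofFinite V
  constructor
  · rintro ⟨U, -, hcov, hcard⟩
    apply le_antisymm
    · rw [matchingNumber_noncyclicPart]
      refine le_trans ?_ ((Finset.card_image_le (s := U) (f := classOf G)).trans hcard)
      refine matchingNumber_le_card_of_cover (U := U.image (classOf G)) fun q r hqr => ?_
      obtain ⟨hne, a, b, hab, rfl, rfl⟩ := contraction_adj.1 hqr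
      exact (hcov a b hab fun hc => hne (classOf_eq_of_core_adj hc)).imp
        (Finset.mem_image_of_mem _) (Finset.mem_image_of_mem _)
    · exact matchingNumber_le_of_injOn Subtype.val Subtype.val_injective.injOn fun _ _ h => h
  · intro hm
    obtain ⟨T, hT, hTcard⟩ := exists_cover_of_core_eq_bot (core_contraction (G := G))
    have h1 : matchingNumber (noncyclicPart G) ≤
        (T.subtype (· ∈ ((cyclicVertices G)ᶜ : Set (ContractedVertex G)))).card := by
      refine matchingNumber_le_card_of_cover fun q r hqr => ?_
      simpa only [Finset.mem_subtype] using hT q.1 r.1 hqr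
    rw [Finset.card_subtype] at h1
    have h2 : ∀ q ∈ T, q ∉ cyclicVertices G := by
      have := Finset.eq_of_subset_of_card_le (Finset.filter_subset
        (· ∈ ((cyclicVertices G)ᶜ : Set (ContractedVertex G))) T) (by omega)
      intro q hq
      rw [← this] at hq
      exact (Finset.mem_filter.1 hq).2
    have h3 : ∀ v, classOf G v ∈ T → v ∉ (core G).support :=
      fun v hv hc => h2 _ hv (classOf_mem_cyclicVertices_iff.2 hc)
    refine ⟨Finset.univ.filter fun v => classOf G v ∈ T, ?_, ?_, ?_⟩
    · intro u hu
      exact h3 u (Finset.mem_filter.1 hu).2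
    · intro a b hab hc
      simpa using hT _ _ (contraction_adj_classOf hab hc)
    · rw [← matchingNumber_noncyclicPart, ← hm]
      refine le_trans ?_ hTcard
      refine Finset.card_le_card_of_injOn (classOf G) (fun v hv => ?_) fun v hv w _ hvw => ?_
      · simpa using hv
      · exact eq_of_classOf_eq (h3 v (by simpa using hv)) hvw

end Contraction

end GraphInertia

theorem theorem4p7 {V : Type*} [Fintype V] [DecidableEq V] (G : SimpleGraph V)
    [DecidableRel G.Adj] :
    (GraphInertia.posInertia G : ℤ) =
        (GraphInertia.matchingNumber G : ℤ) + GraphInertia.cyclomaticNumber G ↔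
      GraphInertia.CyclesDisjoint G ∧
      (∀ (v : V) (p : G.Walk v v), p.IsCycle → p.length ≡ 1 [MOD 4]) ∧
      GraphInertia.matchingNumber (GraphInertia.contraction G) =
        GraphInertia.matchingNumber (GraphInertia.noncyclicPart G) := by
  rw [GraphInertia.cyclesDisjoint_iff, GraphInertia.forall_length_iff,
    ← GraphInertia.exists_bridgeCover_iff, GraphInertia.posInertia_eq_sigPos]
  exact GraphInertia.isExtremal_iff_cycleCriterion
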